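/- Let $d\ge 0$, $q\ge 1$ be integers, let $\phi=(\phi_1,\dots,\phi_q):[0,1]^d\to\mathbb{R}^q$ be bounded and Borel measurable with first coordinate $\phi_1\equiv 1$ (property (P1)), and let $\alpha\in\mathbb{R}^q$. Let $\mathcal{C}_d$ be the set of copula distributions with pdf, i.e. probability distributions $P$ on $[0,1]^d$ that have a density $p$ with respect to Lebesgue measure and whose one-dimensional marginals are all uniform on $[0,1]$. Let $h(P)=-\int_{[0,1]^d}p\log p\,du\in[-\infty,0]$ be the differential entropy of $P\in\mathcal{C}_d$. Call $P\in\mathcal{C}_d$ \emph{feasible} if $E_P[\phi(u)]=\alpha$, and consider the problem $$\max_{P\in\mathcal{C}_d}\ h(P)\quad\text{subject to}\quad E_P[\phi(u)]=\alpha.\tag{MIND}$$ Assume that there is a feasible $P$ with finite differential entropy. Then: 1. (MIND) has exactly one solution $P_{\mathrm M}$. 2. Every feasible copula distribution whose density has the form $$e^{\theta^{T}\phi(u)}\prod_{i=1}^d f_i(u_i)\tag{$*$}$$ for some $\theta\in\mathbb{R}^q$ and some non-negative functions $f_1,\dots,f_d$ on $[0,1]$ with $\log f_i\in L^1([0,1])$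 (so that $f_i>0$ almost everywhere) is equal to $P_{\mathrm M}$. 3. If, moreover, some feasible $P$ with finite differential entropy has a density that is positive almost everywhere on $[0,1]^d$, then the density of $P_{\mathrm M}$ has the form $(*)$, so that $P_{\mathrm M}$ is the only feasible copula distribution with a density of that form; and for every feasible $P$ (with finite entropy or not) $$h(P_{\mathrm M})-h(P)=KL(P\,\|\,P_{\mathrm M})\in[0,\infty].$$ -/

import Mathlib

open MeasureTheory InformationTheory
open scoped unitInterval

/-- The unit cube `[0,1]^d`; its `volume` is the uniform distribution on the cube. -/
abbrev Cube (d : ℕ) : Type := Fin d → I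

/-- The space `𝒞_d` of copula distributions with a pdf: probability measures on `[0,1]^d`
with a density with respect to Lebesgue measure and with uniform one-dimensional marginals. -/
def copulasWithPdf (d : ℕ) : Set (Measure (Cube d)) :=
  {P | IsProbabilityMeasure P ∧ P ≪ volume ∧
    ∀ i : Fin d, P.map (fun u : Cube d => u i) = (volume : Measure I)}

/-- The pdf of `P` (a measure on the cube that is absolutely continuous). -/
noncomputable def pdfOf {d : ℕ} (P : Measure (Cube d)) (u : Cube d) : ℝ :=
  (P.rnDeriv volume u).toReal

/-- Differential entropy `h(P) = -∫ p log p` of a distribution on the cube with pdf `p`, as the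
difference of the integrals of the positive and the negative part of `-p log p`. As `-p log p ≤ 1`,
the first integral is finite, so that `h(P)` is well defined in `[-∞, ∞)`. -/
noncomputable def diffEntropy {d : ℕ} (P : Measure (Cube d)) : EReal :=
  ((∫⁻ u : Cube d, ENNReal.ofReal (Real.negMulLog (pdfOf P u)) : ENNReal) : EReal) -
    ((∫⁻ u : Cube d, ENNReal.ofReal (-Real.negMulLog (pdfOf P u)) : ENNReal) : EReal)

/-- `P` has finite differential entropy. -/
def HasFiniteEntropy {d : ℕ} (P : Measure (Cube d)) : Prop :=
  diffEntropy P ≠ ⊥ ∧ diffEntropy P ≠ ⊤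

/-- The feasible set of the problem: copula distributions with pdf such that `E_P[φ] = α`. -/
def feasibleCopulas {d q : ℕ} (φ : Cube d → Fin q → ℝ) (α : Fin q → ℝ) :
    Set (Measure (Cube d)) :=
  {P | P ∈ copulasWithPdf d ∧
    ∀ j : Fin q, Integrable (fun u => φ u j) P ∧ ∫ u, φ u j ∂P = α j}

/-- `P` solves the maximum-entropy copula problem: maximize `h(P)` over the feasible set. -/
def IsMaxEntropyCopula {d q : ℕ} (φ : Cube d → Fin q → ℝ) (α : Fin q → ℝ)
    (P : Measure (Cube d)) : Prop :=
  P ∈ feasibleCopulas φ α ∧ IsMaxOn diffEntropy (feasibleCopulas φ α) P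

/-- `P` has a density of the form `exp (θᵀ φ(u)) ∏ᵢ fᵢ(uᵢ)` for some vector `θ` and non-negative
functions `fᵢ` with `log fᵢ ∈ L¹([0,1])`. Since `Real.log 0 = 0` in Lean, the requirement
`log fᵢ > -∞` almost everywhere, part of `log fᵢ ∈ L¹`, is written out. -/
def HasExponentialForm {d q : ℕ} (φ : Cube d → Fin q → ℝ) (P : Measure (Cube d)) : Prop :=
  ∃ (θ : Fin q → ℝ) (f : Fin d → I → ℝ),
    (∀ i t, 0 ≤ f i t) ∧
    (∀ i, ∀ᵐ t : I, 0 < f i t) ∧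
    (∀ i, Integrable (fun t : I => Real.log (f i t))) ∧
    P = volume.withDensity
      (fun u : Cube d => ENNReal.ofReal (Real.exp (∑ j, θ j * φ u j) * ∏ i, f i (u i)))

/-!
The differential entropy of a copula distribution `P` is `-KL(P ‖ λ)`, where `λ` is the uniform
distribution on the cube, so the problem asks for the `I`-projection of `λ` onto the convex set of
feasible distributions.

A quantitative form of strict convexity bounds the squared `L¹` distance of two densities by the
entropy gap at their midpoint. Hence the minimizer of `KL(· ‖ λ)` is unique, and minimizing
sequences are Cauchy in `L¹`; bounded moment constraints and uniform marginals survive the limit.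
As the derivative of `t log t` at `0` is `-∞`, the minimizer `p` is positive as soon as some
feasible density of finite entropy is.

For positive `p` the first variation `∫ κ log p` vanishes along every bounded `κ` that has vanishing
marginals, is orthogonal to the `φⱼ`, and lives where `p` is bounded away from `0` and `∞`. Such
directions arise from functions of two independent points `x`, `y` as adjoints of the operator
`F ↦ F(x) + (d - 1) F(y) - ∑ᵢ F(y₁, …, xᵢ, …, y_d)`, which vanishes exactly on sums
`∑ᵢ gᵢ(uᵢ)`. A finite-dimensional multiplier argument shows that this operator maps `log p` to a
linear combination of the images of the `φⱼ`, so that `log p = θᵀ φ + ∑ᵢ gᵢ(uᵢ)`. The uniform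
marginals and the boundedness of `φ` then force every `gᵢ` to be essentially bounded.

Conversely, if `Q` is feasible with log-density `θᵀ φ + ∑ᵢ gᵢ(uᵢ)`, this log-density has the same
expectation under every feasible `P`, whence the Pythagorean identity
`KL(P ‖ Q) + KL(Q ‖ λ) = KL(P ‖ λ)`.
-/

section KlFun

/-! ### Inequalities for `klFun` -/

lemma sq_sqrt_sub_one_le_klFun {x : ℝ} (hx : 0 ≤ x) : (√x - 1) ^ 2 ≤ klFun x := by
  rcases hx.eq_or_lt with rfl | hx
  · simp [klFun_zero]
  have hlog : 1 - (√x)⁻¹ ≤ Real.log x / 2 := by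
    simpa only [Real.log_sqrt hx.le] using Real.one_sub_inv_le_log_of_pos (Real.sqrt_pos.2 hx)
  have hdiv : x * (√x)⁻¹ = √x := by rw [← div_eq_mul_inv, Real.div_sqrt]
  rw [klFun_apply]
  nlinarith [mul_le_mul_of_nonneg_left hlog hx.le, Real.sq_sqrt hx.le]

lemma mul_klFun_div {a m : ℝ} (hm : m ≠ 0) :
    m * klFun (a / m) = a * Real.log a - a * Real.log m + m - a := by
  rcases eq_or_ne a 0 with rfl | ha
  · simp [klFun_zero]
  rw [klFun_apply, Real.log_div ha hm]
  field_simp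

lemma sq_sqrt_sub_sqrt_le_mul_klFun_div {a m : ℝ} (ha : 0 ≤ a) (hm : 0 < m) :
    (√a - √m) ^ 2 ≤ m * klFun (a / m) := by
  have hfactor : √a - √m = √m * (√(a / m) - 1) := by
    rw [Real.sqrt_div ha, mul_sub, mul_div_cancel₀ _ (Real.sqrt_pos.2 hm).ne', mul_one]
  rw [hfactor, mul_pow, Real.sq_sqrt hm.le]
  exact mul_le_mul_of_nonneg_left (sq_sqrt_sub_one_le_klFun (by positivity)) hm.le

lemma sq_sqrt_sub_sqrt_le_klFun_gap {a b : ℝ} (ha : 0 ≤ a) (hb : 0 ≤ b) :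
    (√a - √b) ^ 2 ≤ 2 * (klFun a + klFun b - 2 * klFun ((a + b) / 2)) := by
  rcases (add_nonneg ha hb).eq_or_lt with h0 | hpos
  · obtain rfl : a = 0 := by linarith
    obtain rfl : b = 0 := by linarith
    simp [two_mul]
  set m := (a + b) / 2 with hm
  have hmpos : 0 < m := by positivity
  have hgap : klFun a + klFun b - 2 * klFun m = m * klFun (a / m) + m * klFun (b / m) := by
    rw [mul_klFun_div hmpos.ne', mul_klFun_div hmpos.ne']
    simp only [klFun_apply, hm]
    ring
  rw [hgap]
  nlinarith [sq_sqrt_sub_sqrt_le_mul_klFun_div ha hmpos, sq_sqrt_sub_sqrt_le_mul_klFun_div hb hmpos,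
    sq_nonneg (√a + √b - 2 * √m)]

/-- AM-GM in `|a - b| = |√a - √b| (√a + √b)`. -/
lemma abs_sub_le_klFun_gap {a b s : ℝ} (ha : 0 ≤ a) (hb : 0 ≤ b) (hs : 0 < s) :
    |a - b| ≤ s * (a + b) + (klFun a + klFun b - 2 * klFun ((a + b) / 2)) / s := by
  have hgap := sq_sqrt_sub_sqrt_le_klFun_gap ha hb
  set gap := klFun a + klFun b - 2 * klFun ((a + b) / 2)
  set x := |√a - √b|
  set y := √a + √b
  have hxy : |a - b| = x * y := by
    rw [← abs_of_nonneg (show 0 ≤ y by positivity), ← abs_mul, mul_comm,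
      ← sq_sub_sq, Real.sq_sqrt ha, Real.sq_sqrt hb]
  have hx : x ^ 2 ≤ 2 * gap := by rwa [sq_abs]
  have hy : y ^ 2 ≤ 2 * (a + b) := by
    nlinarith [sq_nonneg (√a - √b), Real.sq_sqrt ha, Real.sq_sqrt hb]
  calc |a - b| = x * y := hxy
    _ ≤ s * (y ^ 2 / 2) + x ^ 2 / 2 / s := by
        have hsq : s * (y ^ 2 / 2) + x ^ 2 / 2 / s - x * y = (s * y - x) ^ 2 / (2 * s) := by
          field_simp
          ring
        have : 0 ≤ (s * y - x) ^ 2 / (2 * s) := by positivity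
        linarith
    _ ≤ s * (a + b) + gap / s := by
        gcongr <;> linarith

lemma klFun_add_le {a x : ℝ} (ha : 0 < a) (hax : 0 ≤ a + x) :
    klFun (a + x) ≤ klFun a + x * Real.log a + x ^ 2 / a := by
  rcases hax.eq_or_lt with h | h
  · obtain rfl : x = -a := by linarith
    rw [add_neg_cancel, klFun_zero, klFun_apply, neg_sq, sq, mul_div_cancel_left₀ _ ha.ne']
    linarith
  have hlog : Real.log (a + x) - Real.log a ≤ (a + x) / a - 1 := by
    rw [← Real.log_div h.ne' ha.ne']
    exact Real.log_le_sub_one_of_pos (by positivity)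
  have hquad : (a + x) * ((a + x) / a - 1) = x + x ^ 2 / a := by
    field_simp
    ring
  simp only [klFun_apply]
  nlinarith [mul_le_mul_of_nonneg_left hlog h.le]

lemma klFun_convexComb_le {a b s t : ℝ} (ha : 0 ≤ a) (hb : 0 ≤ b) (hs : 0 ≤ s) (ht : 0 ≤ t)
    (hst : s + t = 1) : klFun (s * a + t * b) ≤ s * klFun a + t * klFun b :=
  convexOn_klFun.2 ha hb hs ht hst

end KlFun

section EntropyMinimization

/-! ### Minimizing the relative entropy over a convex set of densities -/

open Filter Topology

variable {Ω : Type*} [MeasurableSpace Ω] {μ : Measure Ω} {𝒟 : Set (Ω → ℝ)} {p p' : Ω → ℝ}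

/-- A (pointwise non-negative) probability density with respect to `μ`. -/
structure IsProbDensity (μ : Measure Ω) (p : Ω → ℝ) : Prop where
  measurable : Measurable p
  nonneg : ∀ x, 0 ≤ p x
  integrable : Integrable p μ
  integral_eq_one : ∫ x, p x ∂μ = 1

/-- `p` minimizes `∫ klFun p ∂μ`, the entropy of the distribution with density `p` relative to `μ`,
among the elements of `𝒟` of finite relative entropy. -/
structure IsEntropyMinimizer (μ : Measure Ω) (𝒟 : Set (Ω → ℝ)) (p : Ω → ℝ) : Prop where
  mem : p ∈ 𝒟
  integrable : Integrable (fun x => klFun (p x)) μ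
  le : ∀ p' ∈ 𝒟, Integrable (fun x => klFun (p' x)) μ →
    ∫ x, klFun (p x) ∂μ ≤ ∫ x, klFun (p' x) ∂μ

lemma integrable_klFun_of_le {f g : Ω → ℝ} (hf : Measurable f) (hf0 : ∀ x, 0 ≤ f x)
    (hg : Integrable g μ) (h : ∀ x, klFun (f x) ≤ g x) :
    Integrable (fun x => klFun (f x)) μ :=
  hg.mono' (measurable_klFun.comp hf).aestronglyMeasurable <| .of_forall fun x => by
    simpa only [Real.norm_of_nonneg (klFun_nonneg (hf0 x))] using h x

namespace IsProbDensity

lemma eq_one_of_subsingleton [Subsingleton Ω] [IsProbabilityMeasure μ] (hp : IsProbDensity μ p)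
    (x : Ω) : p x = 1 := by
  have hconst : ∀ y, p y = p x := fun y => congrArg p (Subsingleton.elim y x)
  simpa only [hconst, integral_const, probReal_univ, one_smul] using hp.integral_eq_one

lemma integral_klFun_nonneg (hp : IsProbDensity μ p) : 0 ≤ ∫ x, klFun (p x) ∂μ :=
  integral_nonneg fun x => klFun_nonneg (hp.nonneg x)

lemma convexComb (hp : IsProbDensity μ p) (hp' : IsProbDensity μ p') {s t : ℝ} (hs : 0 ≤ s)
    (ht : 0 ≤ t) (hst : s + t = 1) : IsProbDensity μ (s • p + t • p') where
  measurable := (hp.measurable.const_smul s).add (hp'.measurable.const_smul t)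
  nonneg x := add_nonneg (mul_nonneg hs (hp.nonneg x)) (mul_nonneg ht (hp'.nonneg x))
  integrable := (hp.integrable.smul s).add (hp'.integrable.smul t)
  integral_eq_one := by
    simp only [Pi.add_apply, Pi.smul_apply, smul_eq_mul]
    rw [integral_add (hp.integrable.const_mul s) (hp'.integrable.const_mul t), integral_const_mul,
      integral_const_mul, hp.integral_eq_one, hp'.integral_eq_one, mul_one, mul_one, hst]

lemma integrable_klFun_convexComb (hp : IsProbDensity μ p) (hp' : IsProbDensity μ p')
    (hF : Integrable (fun x => klFun (p x)) μ) (hF' : Integrable (fun x => klFun (p' x)) μ)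
    {s t : ℝ} (hs : 0 ≤ s) (ht : 0 ≤ t) (hst : s + t = 1) :
    Integrable (fun x => klFun ((s • p + t • p') x)) μ :=
  integrable_klFun_of_le (hp.convexComb hp' hs ht hst).measurable
    (hp.convexComb hp' hs ht hst).nonneg ((hF.const_mul s).add (hF'.const_mul t))
    fun x => klFun_convexComb_le (hp.nonneg x) (hp'.nonneg x) hs ht hst

/-- Optimizing `abs_sub_le_klFun_gap` over `s` after integration. -/
lemma sq_integral_abs_sub_le_entropy_gap (hp : IsProbDensity μ p) (hp' : IsProbDensity μ p')
    (hF : Integrable (fun x => klFun (p x)) μ) (hF' : Integrable (fun x => klFun (p' x)) μ) :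
    (∫ x, |p x - p' x| ∂μ) ^ 2 ≤ 8 * (∫ x, klFun (p x) ∂μ + ∫ x, klFun (p' x) ∂μ
      - 2 * ∫ x, klFun ((p x + p' x) / 2) ∂μ) := by
  have hmid : Integrable (fun x => klFun ((p x + p' x) / 2)) μ := by
    convert hp.integrable_klFun_convexComb hp' hF hF' (s := 1 / 2) (t := 1 / 2)
      (by norm_num) (by norm_num) (by norm_num) using 3
    simp only [Pi.add_apply, Pi.smul_apply, smul_eq_mul]
    ring
  set gap : Ω → ℝ := fun x => klFun (p x) + klFun (p' x) - 2 * klFun ((p x + p' x) / 2)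
  have hsum : Integrable (fun x => klFun (p x) + klFun (p' x)) μ := hF.add hF'
  have hgap : Integrable gap μ := hsum.sub (hmid.const_mul 2)
  have hgap_eq : ∫ x, gap x ∂μ = ∫ x, klFun (p x) ∂μ + ∫ x, klFun (p' x) ∂μ
      - 2 * ∫ x, klFun ((p x + p' x) / 2) ∂μ := by
    rw [integral_sub hsum (hmid.const_mul 2), integral_add hF hF', integral_const_mul]
  have hgap0 : 0 ≤ ∫ x, gap x ∂μ := integral_nonneg fun x => by
    have := sq_sqrt_sub_sqrt_le_klFun_gap (hp.nonneg x) (hp'.nonneg x)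
    simp only [Pi.zero_apply, gap]
    nlinarith [sq_nonneg (√(p x) - √(p' x))]
  have hbound : ∀ s : ℝ, 0 < s → ∫ x, |p x - p' x| ∂μ ≤ s * 2 + (∫ x, gap x ∂μ) / s := by
    intro s hs
    have hsum : Integrable (fun x => s * (p x + p' x)) μ :=
      (hp.integrable.add hp'.integrable).const_mul s
    calc ∫ x, |p x - p' x| ∂μ ≤ ∫ x, (s * (p x + p' x) + gap x / s) ∂μ :=
          integral_mono (hp.integrable.sub hp'.integrable).abs (hsum.add (hgap.div_const s))
            fun x => abs_sub_le_klFun_gap (hp.nonneg x) (hp'.nonneg x) hs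
      _ = s * 2 + (∫ x, gap x ∂μ) / s := by
          rw [integral_add hsum (hgap.div_const s), integral_const_mul,
            integral_add hp.integrable hp'.integrable, hp.integral_eq_one, hp'.integral_eq_one,
            integral_div, one_add_one_eq_two]
  rw [← hgap_eq]
  set X := ∫ x, |p x - p' x| ∂μ
  have hX : 0 ≤ X := integral_nonneg fun x => abs_nonneg (p x - p' x)
  rcases hX.eq_or_lt with hX | hX
  · simpa [← hX] using hgap0
  have h := hbound (X / 4) (by positivity)
  rw [← sub_le_iff_le_add', le_div_iff₀ (by positivity)] at h
  linarith

end IsProbDensity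

/-- Close to the minimal entropy, the midpoint inequality makes densities close in `L¹`. -/
lemma sq_integral_abs_sub_le_of_entropy_ge (h𝒟 : Convex ℝ 𝒟)
    (hdens : ∀ p ∈ 𝒟, IsProbDensity μ p) {m : ℝ}
    (hm : ∀ p ∈ 𝒟, Integrable (fun x => klFun (p x)) μ → m ≤ ∫ x, klFun (p x) ∂μ)
    (hp : p ∈ 𝒟) (hp' : p' ∈ 𝒟)
    (hF : Integrable (fun x => klFun (p x)) μ) (hF' : Integrable (fun x => klFun (p' x)) μ) :
    (∫ x, |p x - p' x| ∂μ) ^ 2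
      ≤ 8 * (∫ x, klFun (p x) ∂μ - m) + 8 * (∫ x, klFun (p' x) ∂μ - m) := by
  have hhalf : (0 : ℝ) ≤ 1 / 2 := by norm_num
  have hmid := hm _ (h𝒟 hp hp' hhalf hhalf (by norm_num))
    ((hdens p hp).integrable_klFun_convexComb (hdens p' hp') hF hF' hhalf hhalf (by norm_num))
  have heq : ∀ x, ((1 / 2 : ℝ) • p + (1 / 2 : ℝ) • p') x = (p x + p' x) / 2 := fun x => by
    simp only [Pi.add_apply, Pi.smul_apply, smul_eq_mul]
    ring
  simp only [heq] at hmid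
  linarith [(hdens p hp).sq_integral_abs_sub_le_entropy_gap (hdens p' hp') hF hF']

lemma IsEntropyMinimizer.ae_eq (h𝒟 : Convex ℝ 𝒟) (hdens : ∀ p ∈ 𝒟, IsProbDensity μ p)
    (hp : IsEntropyMinimizer μ 𝒟 p) (hp' : IsEntropyMinimizer μ 𝒟 p') : p =ᵐ[μ] p' := by
  have hle := sq_integral_abs_sub_le_of_entropy_ge h𝒟 hdens hp.le hp.mem hp'.mem hp.integrable
    hp'.integrable
  have hzero : ∫ x, |p x - p' x| ∂μ = 0 :=
    pow_eq_zero_iff two_ne_zero |>.1 <| le_antisymm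
      (by linarith [hp'.le _ hp.mem hp.integrable]) (sq_nonneg _)
  have hae : (fun x => |p x - p' x|) =ᵐ[μ] 0 :=
    (integral_eq_zero_iff_of_nonneg (fun x => abs_nonneg _)
      ((hdens p hp.mem).integrable.sub (hdens p' hp'.mem).integrable).abs).1 hzero
  filter_upwards [hae] with x hx
  exact sub_eq_zero.1 (abs_eq_zero.1 hx)

lemma ofReal_integral_abs_sub_eq_eLpNorm {f g : Ω → ℝ} (hf : Integrable f μ)
    (hg : Integrable g μ) : ENNReal.ofReal (∫ x, |f x - g x| ∂μ) = eLpNorm (f - g) 1 μ := by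
  rw [eLpNorm_one_eq_lintegral_enorm, ← ofReal_integral_norm_eq_lintegral_enorm (hf.sub hg)]
  rfl

/-- A minimizing sequence is automatically Cauchy in `L¹`. -/
lemma tendsto_eLpNorm_sub_of_tendsto_entropy (h𝒟 : Convex ℝ 𝒟)
    (hdens : ∀ p ∈ 𝒟, IsProbDensity μ p) {m : ℝ}
    (hm : ∀ p ∈ 𝒟, Integrable (fun x => klFun (p x)) μ → m ≤ ∫ x, klFun (p x) ∂μ)
    {f : ℕ → Ω → ℝ} (hf : ∀ n, f n ∈ 𝒟) (hF : ∀ n, Integrable (fun x => klFun (f n x)) μ)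
    (hlim : Tendsto (fun n => ∫ x, klFun (f n x) ∂μ) atTop (𝓝 m)) :
    Tendsto (fun n : ℕ × ℕ => eLpNorm (f n.1 - f n.2) 1 μ) atTop (𝓝 0) := by
  have hexcess : Tendsto (fun n => 8 * (∫ x, klFun (f n x) ∂μ - m)) atTop (𝓝 0) := by
    simpa using (hlim.sub_const m).const_mul 8
  have hsum : Tendsto (fun n : ℕ × ℕ => 8 * (∫ x, klFun (f n.1 x) ∂μ - m)
      + 8 * (∫ x, klFun (f n.2 x) ∂μ - m)) atTop (𝓝 0) := by
    rw [← prod_atTop_atTop_eq]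
    simpa using (hexcess.comp tendsto_fst).add (hexcess.comp tendsto_snd)
  have hL1 : Tendsto (fun n : ℕ × ℕ => ∫ x, |f n.1 x - f n.2 x| ∂μ) atTop (𝓝 0) := by
    refine squeeze_zero (fun n => integral_nonneg fun x => abs_nonneg _)
      (fun n => Real.le_sqrt_of_sq_le ?_) (by simpa using hsum.sqrt)
    exact sq_integral_abs_sub_le_of_entropy_ge h𝒟 hdens hm (hf _) (hf _) (hF _) (hF _)
  simpa only [ofReal_integral_abs_sub_eq_eLpNorm (hdens _ (hf _)).integrable
    (hdens _ (hf _)).integrable, ENNReal.ofReal_zero] using ENNReal.tendsto_ofReal hL1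

lemma IsProbDensity.of_tendsto_eLpNorm {f : ℕ → Ω → ℝ} (hf : ∀ n, IsProbDensity μ (f n))
    (hpm : Measurable p) (hp0 : ∀ x, 0 ≤ p x) (hpi : Integrable p μ)
    (hlim : Tendsto (fun n => eLpNorm (f n - p) 1 μ) atTop (𝓝 0)) : IsProbDensity μ p where
  measurable := hpm
  nonneg := hp0
  integrable := hpi
  integral_eq_one := by
    have := tendsto_integral_of_L1' p hpi.aestronglyMeasurable
      (.of_forall fun n => (hf n).integrable) hlim
    simp only [(hf _).integral_eq_one] at this
    exact tendsto_nhds_unique this tendsto_const_nhds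

lemma exists_isProbDensity_tendsto_eLpNorm {f : ℕ → Ω → ℝ} (hf : ∀ n, IsProbDensity μ (f n))
    (hcauchy : Tendsto (fun n : ℕ × ℕ => eLpNorm (f n.1 - f n.2) 1 μ) atTop (𝓝 0)) :
    ∃ p, IsProbDensity μ p ∧ Tendsto (fun n => eLpNorm (f n - p) 1 μ) atTop (𝓝 0) := by
  have hmem : ∀ n, MemLp (f n) 1 μ := fun n => memLp_one_iff_integrable.2 (hf n).integrable
  obtain ⟨G, hG⟩ := cauchySeq_tendsto_of_complete
    (u := fun n => (hmem n).toLp) ((Lp.cauchySeq_Lp_iff_cauchySeq_eLpNorm _).2 (by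
      simpa only [eLpNorm_congr_ae ((hmem _).coeFn_toLp.sub (hmem _).coeFn_toLp)] using hcauchy))
  rw [← Lp.toLp_coeFn G (Lp.memLp G), Lp.tendsto_Lp_iff_tendsto_eLpNorm''] at hG
  have hGi : Integrable G μ := L1.integrable_coeFn G
  have hlim : Tendsto (fun n => eLpNorm (f n - fun x => max (G x) 0) 1 μ) atTop (𝓝 0) := by
    refine tendsto_of_tendsto_of_tendsto_of_le_of_le tendsto_const_nhds hG (fun _ => bot_le)
      fun n => eLpNorm_mono fun x => ?_
    simpa only [Pi.sub_apply, Real.norm_eq_abs, max_eq_left ((hf n).nonneg x)]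
      using abs_max_sub_max_le_abs (f n x) (G x) 0
  exact ⟨_, .of_tendsto_eLpNorm hf ((Lp.stronglyMeasurable G).measurable.max measurable_const)
    (fun x => le_max_right _ _) hGi.pos_part hlim, hlim⟩

/-- Lower semicontinuity of the relative entropy, from Fatou's lemma along an almost everywhere
convergent subsequence. -/
lemma IsProbDensity.lintegral_klFun_le_of_tendsto {f : ℕ → Ω → ℝ}
    (hf : ∀ n, IsProbDensity μ (f n)) (hp : IsProbDensity μ p)
    (hF : ∀ n, Integrable (fun x => klFun (f n x)) μ)
    (hlim : Tendsto (fun n => eLpNorm (f n - p) 1 μ) atTop (𝓝 0)) {m : ℝ}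
    (hm : Tendsto (fun n => ∫ x, klFun (f n x) ∂μ) atTop (𝓝 m)) :
    ∫⁻ x, ENNReal.ofReal (klFun (p x)) ∂μ ≤ ENNReal.ofReal m := by
  obtain ⟨ns, hns, hae⟩ := (tendstoInMeasure_of_tendsto_eLpNorm one_ne_zero
    (fun n => (hf n).integrable.aestronglyMeasurable) hp.integrable.aestronglyMeasurable
    hlim).exists_seq_tendsto_ae
  calc ∫⁻ x, ENNReal.ofReal (klFun (p x)) ∂μ
      = ∫⁻ x, liminf (fun i => ENNReal.ofReal (klFun (f (ns i) x))) atTop ∂μ := by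
        refine lintegral_congr_ae ?_
        filter_upwards [hae] with x hx
        exact (((ENNReal.continuous_ofReal.comp continuous_klFun).tendsto _).comp
          hx).liminf_eq.symm
    _ ≤ liminf (fun i => ∫⁻ x, ENNReal.ofReal (klFun (f (ns i) x)) ∂μ) atTop :=
        lintegral_liminf_le fun i => (measurable_klFun.comp (hf _).measurable).ennreal_ofReal
    _ = liminf (fun i => ENNReal.ofReal (∫ x, klFun (f (ns i) x) ∂μ)) atTop := by
        congr 1 with i
        exact (ofReal_integral_eq_lintegral_ofReal (hF _)
          (.of_forall fun x => klFun_nonneg ((hf _).nonneg x))).symm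
    _ = ENNReal.ofReal m :=
        ((ENNReal.continuous_ofReal.tendsto _).comp (hm.comp hns.tendsto_atTop)).liminf_eq

lemma IsProbDensity.integrable_klFun_of_tendsto {f : ℕ → Ω → ℝ}
    (hf : ∀ n, IsProbDensity μ (f n)) (hp : IsProbDensity μ p)
    (hF : ∀ n, Integrable (fun x => klFun (f n x)) μ)
    (hlim : Tendsto (fun n => eLpNorm (f n - p) 1 μ) atTop (𝓝 0)) {m : ℝ}
    (hm : Tendsto (fun n => ∫ x, klFun (f n x) ∂μ) atTop (𝓝 m)) :
    Integrable (fun x => klFun (p x)) μ ∧ ∫ x, klFun (p x) ∂μ ≤ m := by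
  have hle := lintegral_klFun_le_of_tendsto hf hp hF hlim hm
  have hnonneg : 0 ≤ᵐ[μ] fun x => klFun (p x) := .of_forall fun x => klFun_nonneg (hp.nonneg x)
  have hint : Integrable (fun x => klFun (p x)) μ :=
    ⟨(measurable_klFun.comp hp.measurable).aestronglyMeasurable,
      (hasFiniteIntegral_iff_ofReal hnonneg).2 (hle.trans_lt ENNReal.ofReal_lt_top)⟩
  refine ⟨hint, ?_⟩
  rw [← ofReal_integral_eq_lintegral_ofReal hint hnonneg] at hle
  exact (ENNReal.ofReal_le_ofReal_iff
    (ge_of_tendsto' hm fun n => (hf n).integral_klFun_nonneg)).1 hle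

/-- Csiszár's theorem on `I`-projections. -/
theorem exists_isEntropyMinimizer (h𝒟 : Convex ℝ 𝒟) (hdens : ∀ p ∈ 𝒟, IsProbDensity μ p)
    (hclosed : ∀ (f : ℕ → Ω → ℝ) (p : Ω → ℝ), (∀ n, f n ∈ 𝒟) → IsProbDensity μ p →
      Tendsto (fun n => eLpNorm (f n - p) 1 μ) atTop (𝓝 0) → p ∈ 𝒟)
    (hfin : ∃ p ∈ 𝒟, Integrable (fun x => klFun (p x)) μ) :
    ∃ p, IsEntropyMinimizer μ 𝒟 p := by
  set S : Set ℝ :=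
    (fun p : Ω → ℝ => ∫ x, klFun (p x) ∂μ) '' {p ∈ 𝒟 | Integrable (fun x => klFun (p x)) μ}
  have hbdd : BddBelow S := by
    refine ⟨0, ?_⟩
    rintro _ ⟨p, ⟨hp, -⟩, rfl⟩
    exact (hdens p hp).integral_klFun_nonneg
  have hinf : ∀ p ∈ 𝒟, Integrable (fun x => klFun (p x)) μ → sInf S ≤ ∫ x, klFun (p x) ∂μ :=
    fun p hp hI => csInf_le hbdd ⟨p, ⟨hp, hI⟩, rfl⟩
  obtain ⟨p₀, hp₀, hI₀⟩ := hfin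
  obtain ⟨y, -, hy, hyS⟩ := exists_seq_tendsto_sInf (S := S) ⟨_, p₀, ⟨hp₀, hI₀⟩, rfl⟩ hbdd
  choose f hf hfy using hyS
  obtain rfl : _ = y := funext hfy
  have hfdens : ∀ n, IsProbDensity μ (f n) := fun n => hdens _ (hf n).1
  obtain ⟨p, hp, hlim⟩ := exists_isProbDensity_tendsto_eLpNorm hfdens
    (tendsto_eLpNorm_sub_of_tendsto_entropy h𝒟 hdens hinf (fun n => (hf n).1) (fun n => (hf n).2)
      hy)
  obtain ⟨hI, hle⟩ := hp.integrable_klFun_of_tendsto hfdens (fun n => (hf n).2) hlim hy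
  exact ⟨p, hclosed f p (fun n => (hf n).1) hp hlim, hI,
    fun p' hp' hI' => hle.trans (hinf p' hp' hI')⟩

/-- Moving a little mass `t p'` onto `{p = 0}` changes the entropy there by `t log t ∫ p'` to
leading order, which minimality cannot tolerate as `log t → -∞`. -/
lemma IsEntropyMinimizer.neg_entropy_le_log_mul (h𝒟 : Convex ℝ 𝒟)
    (hdens : ∀ p ∈ 𝒟, IsProbDensity μ p) (hp : IsEntropyMinimizer μ 𝒟 p) (hp' : p' ∈ 𝒟)
    (hF' : Integrable (fun x => klFun (p' x)) μ) {t : ℝ} (ht : 0 < t) (ht1 : t < 1) :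
    -(∫ x, klFun (p' x) ∂μ) ≤ Real.log t * ∫ x in {x | p x = 0}, p' x ∂μ := by
  have hpd := hdens p hp.mem
  have hpd' := hdens p' hp'
  set A := {x | p x = 0}
  have hA : MeasurableSet A := hpd.measurable (measurableSet_singleton 0)
  have h1t : 0 ≤ 1 - t := by linarith
  have hmix := hpd.integrable_klFun_convexComb hpd' hp.integrable hF' h1t ht.le (by ring)
  have hmin := hp.le _ (h𝒟 hp.mem hp' h1t ht.le (by ring)) hmix
  have hconv : Integrable (fun x => (1 - t) * klFun (p x) + t * klFun (p' x)) μ :=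
    (hp.integrable.const_mul _).add (hF'.const_mul _)
  have hcorr : Integrable (fun x => t * Real.log t * A.indicator p' x) μ :=
    (hpd'.integrable.indicator hA).const_mul _
  have hpointwise : ∀ x, klFun (((1 - t) • p + t • p') x)
      ≤ (1 - t) * klFun (p x) + t * klFun (p' x) + t * Real.log t * A.indicator p' x := by
    intro x
    simp only [Pi.add_apply, Pi.smul_apply, smul_eq_mul]
    by_cases hx : p x = 0
    · rw [Set.indicator_of_mem (show x ∈ A from hx), hx]
      rcases eq_or_ne (p' x) 0 with hx' | hx'
      · simp [hx', klFun_zero]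
      · simp only [klFun_apply, mul_zero, zero_add, Real.log_mul ht.ne' hx']
        exact le_of_eq (by ring)
    · rw [Set.indicator_of_notMem (show x ∉ A from hx), mul_zero, add_zero]
      exact klFun_convexComb_le (hpd.nonneg x) (hpd'.nonneg x) h1t ht.le (by ring)
  have hupper := hmin.trans (integral_mono hmix (hconv.add hcorr) hpointwise)
  simp only [Pi.add_apply] at hupper
  rw [integral_add hconv hcorr, integral_add (hp.integrable.const_mul _) (hF'.const_mul _),
    integral_const_mul, integral_const_mul, integral_const_mul, integral_indicator hA] at hupper
  have hnonneg : 0 ≤ t * (∫ x, klFun (p' x) ∂μ + Real.log t * ∫ x in A, p' x ∂μ) := by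
    linarith [mul_nonneg ht.le hpd.integral_klFun_nonneg]
  linarith [nonneg_of_mul_nonneg_right hnonneg ht]

theorem IsEntropyMinimizer.ae_pos (h𝒟 : Convex ℝ 𝒟) (hdens : ∀ p ∈ 𝒟, IsProbDensity μ p)
    (hp : IsEntropyMinimizer μ 𝒟 p) (hp' : p' ∈ 𝒟)
    (hF' : Integrable (fun x => klFun (p' x)) μ) (hpos : ∀ᵐ x ∂μ, 0 < p' x) :
    ∀ᵐ x ∂μ, 0 < p x := by
  have hpd' := hdens p' hp'
  have hzero : ∫ x in {x | p x = 0}, p' x ∂μ = 0 := by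
    refine (integral_nonneg fun x => hpd'.nonneg x).antisymm' (not_lt.1 fun hI => ?_)
    have hlow := (Real.tendsto_log_nhdsGT_zero.atBot_mul_const hI).eventually
      (eventually_lt_atBot (-(∫ x, klFun (p' x) ∂μ)))
    obtain ⟨t, hlt, ht⟩ := (hlow.and (Ioo_mem_nhdsGT one_pos)).exists
    exact hlt.not_ge (hp.neg_entropy_le_log_mul h𝒟 hdens hp' hF' ht.1 ht.2)
  have hA : MeasurableSet {x | p x = 0} :=
    (hdens p hp.mem).measurable (measurableSet_singleton 0)
  rw [setIntegral_eq_zero_iff_of_nonneg_ae (.of_forall fun x => hpd'.nonneg x)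
    hpd'.integrable.integrableOn, EventuallyEq, ae_restrict_iff' hA] at hzero
  filter_upwards [hzero, hpos] with x hx hx'
  exact ((hdens p hp.mem).nonneg x).lt_of_ne fun h => hx'.ne' (hx h.symm)

lemma abs_log_le_of_mem_Icc_inv {ε a : ℝ} (hε : 0 < ε) (ha : a ∈ Set.Icc ε ε⁻¹) :
    |Real.log a| ≤ |Real.log ε| := by
  have hlow := Real.log_le_log hε ha.1
  have hupp := Real.log_le_log (hε.trans_le ha.1) ha.2
  rw [Real.log_inv] at hupp
  exact abs_le.2 ⟨by linarith [neg_abs_le (Real.log ε)], by linarith [neg_le_abs (Real.log ε)]⟩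

lemma integrable_mul_log_of_mem_Icc [IsFiniteMeasure μ] (hp : Measurable p) {κ : Ω → ℝ}
    (hκ : Measurable κ) {B ε : ℝ} (hε : 0 < ε) (hB : ∀ x, |κ x| ≤ B)
    (hsupp : ∀ x, κ x ≠ 0 → p x ∈ Set.Icc ε ε⁻¹) :
    Integrable (fun x => κ x * Real.log (p x)) μ := by
  refine .of_bound (hκ.mul (Real.measurable_log.comp hp)).aestronglyMeasurable
    (B * |Real.log ε|) (.of_forall fun x => ?_)
  have hB0 : 0 ≤ B := (abs_nonneg _).trans (hB x)
  rw [Real.norm_eq_abs, abs_mul]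
  by_cases hx : κ x = 0
  · rw [hx, abs_zero, zero_mul]
    positivity
  · exact mul_le_mul (hB x) (abs_log_le_of_mem_Icc_inv hε (hsupp x hx)) (abs_nonneg _) hB0

/-- The first-order condition for a variation `κ` living where `p` is bounded away from `0`
and `∞`: there the entropy of `p + t κ` is at most that of `p` plus a quadratic polynomial in `t`
with linear term `t ∫ κ log p`. -/
theorem IsEntropyMinimizer.integral_mul_log_eq_zero [IsFiniteMeasure μ]
    (hdens : ∀ p ∈ 𝒟, IsProbDensity μ p) (hp : IsEntropyMinimizer μ 𝒟 p) {κ : Ω → ℝ}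
    (hκ : Measurable κ) {B ε : ℝ} (hε : 0 < ε) (hB : ∀ x, |κ x| ≤ B)
    (hsupp : ∀ x, κ x ≠ 0 → p x ∈ Set.Icc ε ε⁻¹) (hvar : ∀ᶠ t in 𝓝 (0 : ℝ), p + t • κ ∈ 𝒟) :
    ∫ x, κ x * Real.log (p x) ∂μ = 0 := by
  have hκlog := integrable_mul_log_of_mem_Icc (hdens p hp.mem).measurable (μ := μ) hκ hε hB hsupp
  set J := ∫ x, κ x * Real.log (p x) ∂μ
  set Q := μ.real Set.univ * (B ^ 2 / ε)
  have hquad : ∀ t : ℝ, p + t • κ ∈ 𝒟 → 0 ≤ t * J + t ^ 2 * Q := by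
    intro t ht
    have hpt := hdens _ ht
    have hpointwise : ∀ x, klFun ((p + t • κ) x)
        ≤ klFun (p x) + t * (κ x * Real.log (p x)) + t ^ 2 * (B ^ 2 / ε) := by
      intro x
      simp only [Pi.add_apply, Pi.smul_apply, smul_eq_mul]
      by_cases hx : κ x = 0
      · simp only [hx, mul_zero, zero_mul, add_zero, le_add_iff_nonneg_right]
        positivity
      have hpx := (hsupp x hx).1
      have hsq : (t * κ x) ^ 2 / p x ≤ t ^ 2 * (B ^ 2 / ε) := by
        rw [mul_pow, mul_div_assoc, ← sq_abs (κ x)]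
        gcongr
        exact hB x
      have := klFun_add_le (hε.trans_le hpx) (hpt.nonneg x)
      simp only [Pi.smul_apply, smul_eq_mul] at this
      linarith [mul_assoc t (κ x) (Real.log (p x))]
    have hlin : Integrable (fun x => klFun (p x) + t * (κ x * Real.log (p x))) μ :=
      hp.integrable.add (hκlog.const_mul t)
    have hupp := hlin.add (integrable_const (t ^ 2 * (B ^ 2 / ε)))
    have hint := integrable_klFun_of_le hpt.measurable hpt.nonneg hupp hpointwise
    have hle := (hp.le _ ht hint).trans (integral_mono hint hupp hpointwise)
    simp only [Pi.add_apply] at hle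
    rw [integral_add hlin (integrable_const _), integral_add hp.integrable (hκlog.const_mul t),
      integral_const_mul, integral_const, smul_eq_mul] at hle
    linarith
  have hmin : IsLocalMin (fun t : ℝ => t * J + t ^ 2 * Q) 0 := by
    filter_upwards [hvar] with t ht
    simpa using hquad t ht
  have hderiv : HasDerivAt (fun t : ℝ => t * J + t ^ 2 * Q) J 0 := by
    simpa using
      ((hasDerivAt_id (0 : ℝ)).mul_const J).fun_add (((hasDerivAt_id 0).pow 2).mul_const Q)
  exact hmin.hasDerivAt_eq_zero hderiv

end EntropyMinimization

section MomentDensities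

open Filter Topology

variable {Ω K : Type*} [MeasurableSpace Ω] {μ : Measure Ω} {ψ : K → Ω → ℝ} {c : K → ℝ}

/-- The probability densities under which each `ψ k` has expectation `c k`. -/
def momentDensities (μ : Measure Ω) (ψ : K → Ω → ℝ) (c : K → ℝ) : Set (Ω → ℝ) :=
  {p | IsProbDensity μ p ∧ ∀ k, ∫ x, ψ k x * p x ∂μ = c k}

lemma integrable_mul_of_abs_le {g f : Ω → ℝ} (hg : Measurable g) (hC : ∃ C, ∀ x, |g x| ≤ C)
    (hf : Integrable f μ) : Integrable (fun x => g x * f x) μ :=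
  hf.bdd_mul hg.aestronglyMeasurable (.of_forall hC.choose_spec)

lemma convex_momentDensities (hψ : ∀ k, Measurable (ψ k)) (hC : ∀ k, ∃ C, ∀ x, |ψ k x| ≤ C) :
    Convex ℝ (momentDensities μ ψ c) := by
  intro p hp p' hp' s t hs ht hst
  refine ⟨hp.1.convexComb hp'.1 hs ht hst, fun k => ?_⟩
  have hexpand : ∀ x, ψ k x * (s • p + t • p') x = s * (ψ k x * p x) + t * (ψ k x * p' x) :=
    fun x => by
      simp only [Pi.add_apply, Pi.smul_apply, smul_eq_mul]
      ring
  simp only [hexpand]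
  rw [integral_add ((integrable_mul_of_abs_le (hψ k) (hC k) hp.1.integrable).const_mul s)
    ((integrable_mul_of_abs_le (hψ k) (hC k) hp'.1.integrable).const_mul t), integral_const_mul,
    integral_const_mul, hp.2, hp'.2, ← add_mul, hst, one_mul]

lemma tendsto_integral_mul_of_tendsto_eLpNorm {f : ℕ → Ω → ℝ} {g p : Ω → ℝ} (hg : Measurable g)
    {C : ℝ} (hC : ∀ x, |g x| ≤ C) (hf : ∀ n, Integrable (f n) μ) (hp : Integrable p μ)
    (hlim : Tendsto (fun n => eLpNorm (f n - p) 1 μ) atTop (𝓝 0)) :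
    Tendsto (fun n => ∫ x, g x * f n x ∂μ) atTop (𝓝 (∫ x, g x * p x ∂μ)) := by
  refine tendsto_integral_of_L1' _
    (integrable_mul_of_abs_le hg ⟨C, hC⟩ hp).aestronglyMeasurable
    (.of_forall fun n => integrable_mul_of_abs_le hg ⟨C, hC⟩ (hf n)) ?_
  have hbound : Tendsto (fun n => ENNReal.ofReal C * eLpNorm (f n - p) 1 μ) atTop (𝓝 0) := by
    simpa using ENNReal.Tendsto.const_mul hlim (.inr ENNReal.ofReal_ne_top)
  refine tendsto_of_tendsto_of_tendsto_of_le_of_le tendsto_const_nhds hbound (fun _ => bot_le)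
    fun n => eLpNorm_le_mul_eLpNorm_of_ae_le_mul (.of_forall fun x => ?_) 1
  simp only [Pi.sub_apply, ← mul_sub, norm_mul, Real.norm_eq_abs]
  exact mul_le_mul_of_nonneg_right (hC x) (abs_nonneg _)

lemma mem_momentDensities_of_tendsto_eLpNorm (hψ : ∀ k, Measurable (ψ k))
    (hC : ∀ k, ∃ C, ∀ x, |ψ k x| ≤ C) {f : ℕ → Ω → ℝ} {p : Ω → ℝ}
    (hf : ∀ n, f n ∈ momentDensities μ ψ c) (hp : IsProbDensity μ p)
    (hlim : Tendsto (fun n => eLpNorm (f n - p) 1 μ) atTop (𝓝 0)) :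
    p ∈ momentDensities μ ψ c := by
  refine ⟨hp, fun k => ?_⟩
  obtain ⟨C, hC⟩ := hC k
  have := tendsto_integral_mul_of_tendsto_eLpNorm (hψ k) hC (fun n => (hf n).1.integrable)
    hp.integrable hlim
  simp only [(hf _).2] at this
  exact tendsto_nhds_unique this tendsto_const_nhds

theorem exists_isEntropyMinimizer_momentDensities (hψ : ∀ k, Measurable (ψ k))
    (hC : ∀ k, ∃ C, ∀ x, |ψ k x| ≤ C)
    (hfin : ∃ p ∈ momentDensities μ ψ c, Integrable (fun x => klFun (p x)) μ) :
    ∃ p, IsEntropyMinimizer μ (momentDensities μ ψ c) p :=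
  exists_isEntropyMinimizer (convex_momentDensities hψ hC) (fun _ hp => hp.1)
    (fun _ _ => mem_momentDensities_of_tendsto_eLpNorm hψ hC) hfin

lemma eventually_add_smul_mem_momentDensities [IsFiniteMeasure μ] (hψ : ∀ k, Measurable (ψ k))
    (hC : ∀ k, ∃ C, ∀ x, |ψ k x| ≤ C) {p κ : Ω → ℝ} (hp : p ∈ momentDensities μ ψ c)
    (hκ : Measurable κ) {B ε : ℝ} (hε : 0 < ε) (hB : ∀ x, |κ x| ≤ B)
    (hsupp : ∀ x, κ x ≠ 0 → ε ≤ p x) (hκ1 : ∫ x, κ x ∂μ = 0)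
    (hκψ : ∀ k, ∫ x, ψ k x * κ x ∂μ = 0) :
    ∀ᶠ t in 𝓝 (0 : ℝ), p + t • κ ∈ momentDensities μ ψ c := by
  have hκi : Integrable κ μ := .of_bound hκ.aestronglyMeasurable B (.of_forall hB)
  have hsmall : ∀ᶠ t in 𝓝 (0 : ℝ), |t| * B < ε :=
    (continuous_abs.mul continuous_const).continuousAt.eventually_lt continuousAt_const
      (by simpa using hε)
  filter_upwards [hsmall] with t ht
  refine ⟨⟨hp.1.measurable.add (hκ.const_smul t), fun x => ?_,
    hp.1.integrable.add (hκi.smul t), ?_⟩, fun k => ?_⟩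
  · simp only [Pi.add_apply, Pi.smul_apply, smul_eq_mul]
    by_cases hx : κ x = 0
    · simpa [hx] using hp.1.nonneg x
    have : |t * κ x| ≤ |t| * B := by
      rw [abs_mul]
      exact mul_le_mul_of_nonneg_left (hB x) (abs_nonneg t)
    linarith [neg_abs_le (t * κ x), hsupp x hx]
  · simp only [Pi.add_apply, Pi.smul_apply, smul_eq_mul]
    rw [integral_add hp.1.integrable (hκi.const_mul t), integral_const_mul, hκ1,
      hp.1.integral_eq_one, mul_zero, add_zero]
  · have hexpand : ∀ x, ψ k x * (p + t • κ) x = ψ k x * p x + t * (ψ k x * κ x) := fun x => by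
      simp only [Pi.add_apply, Pi.smul_apply, smul_eq_mul]
      ring
    simp only [hexpand]
    rw [integral_add (integrable_mul_of_abs_le (hψ k) (hC k) hp.1.integrable)
      ((integrable_mul_of_abs_le (hψ k) (hC k) hκi).const_mul t), integral_const_mul, hκψ, hp.2,
      mul_zero, add_zero]

end MomentDensities

section Multipliers

/-! ### Lagrange multipliers against bounded test functions -/

open Filter

variable {Ω J : Type*} [MeasurableSpace Ω] {ν : Measure Ω} {E : ℕ → Set Ω}

/-- The bounded measurable functions vanishing outside one of the increasing sets `E n`. -/
def boundedTestFunctions (E : ℕ → Set Ω) (hE : Monotone E) : Submodule ℝ (Ω → ℝ) where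
  carrier := {w | Measurable w ∧ (∃ B, ∀ x, |w x| ≤ B) ∧ ∃ n, ∀ x ∉ E n, w x = 0}
  zero_mem' := ⟨measurable_zero, ⟨0, fun _ => by simp⟩, 0, fun _ _ => rfl⟩
  add_mem' := by
    rintro v w ⟨hv, ⟨B, hB⟩, n, hn⟩ ⟨hw, ⟨C, hC⟩, m, hm⟩
    refine ⟨hv.add hw, ⟨B + C, fun x => (abs_add_le _ _).trans (add_le_add (hB x) (hC x))⟩,
      max n m, fun x hx => ?_⟩
    rw [Pi.add_apply, hn x fun h => hx (hE (le_max_left n m) h),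
      hm x fun h => hx (hE (le_max_right n m) h), add_zero]
  smul_mem' := by
    rintro a w ⟨hw, ⟨B, hB⟩, n, hn⟩
    refine ⟨hw.const_smul a, ⟨|a| * B, fun x => ?_⟩, n, fun x hx => by simp [hn x hx]⟩
    rw [Pi.smul_apply, smul_eq_mul, abs_mul]
    exact mul_le_mul_of_nonneg_left (hB x) (abs_nonneg a)

lemma integrable_boundedTestFunction_mul {hE : Monotone E} {w G : Ω → ℝ}
    (hw : w ∈ boundedTestFunctions E hE) (hG : ∀ n, IntegrableOn G (E n) ν) :
    Integrable (fun x => w x * G x) ν := by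
  obtain ⟨hwm, hwB, n, hn⟩ := hw
  have hon : IntegrableOn (fun x => w x * G x) (E n) ν := integrable_mul_of_abs_le hwm hwB (hG n)
  exact hon.integrable_of_forall_notMem_eq_zero fun x hx => by rw [hn x hx, zero_mul]

/-- The functional `w ↦ ∫ w G` on `boundedTestFunctions E hE`, for `G` integrable on each `E n`. -/
noncomputable def testIntegral (ν : Measure Ω) (hE : Monotone E) (G : Ω → ℝ)
    (hG : ∀ n, IntegrableOn G (E n) ν) : boundedTestFunctions E hE →ₗ[ℝ] ℝ where
  toFun w := ∫ x, w.1 x * G x ∂ν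
  map_add' v w := by
    simp only [Submodule.coe_add, Pi.add_apply, add_mul]
    exact integral_add (integrable_boundedTestFunction_mul v.2 hG)
      (integrable_boundedTestFunction_mul w.2 hG)
  map_smul' a w := by
    simp only [Submodule.coe_smul, Pi.smul_apply, smul_eq_mul, mul_assoc, integral_const_mul,
      RingHom.id_apply]

lemma ae_eq_zero_of_forall_testIntegral_eq_zero (hE : Monotone E) (hEm : ∀ n, MeasurableSet (E n))
    (hcover : ∀ᵐ x ∂ν, ∃ n, x ∈ E n) {G : Ω → ℝ} (hG : ∀ n, IntegrableOn G (E n) ν)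
    (h : ∀ w, testIntegral ν hE G hG w = 0) : G =ᵐ[ν] 0 := by
  have hlocal : ∀ n, ∀ᵐ x ∂ν, x ∈ E n → G x = 0 := fun n => by
    rw [← ae_restrict_iff' (hEm n)]
    refine (hG n).ae_eq_zero_of_forall_setIntegral_eq_zero fun s hs _ => ?_
    have hw : (s ∩ E n).indicator 1 ∈ boundedTestFunctions E hE :=
      ⟨measurable_one.indicator (hs.inter (hEm n)),
        ⟨1, fun x => by by_cases hx : x ∈ s ∩ E n <;> simp [hx]⟩, n,
        fun x hx => Set.indicator_of_notMem (fun h => hx h.2) _⟩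
    rw [Measure.restrict_restrict hs, ← integral_indicator (hs.inter (hEm n)), ← h ⟨_, hw⟩]
    refine integral_congr_ae (.of_forall fun x => ?_)
    by_cases hx : x ∈ s ∩ E n <;> simp [hx]
  filter_upwards [hcover, ae_all_iff.2 hlocal] with x ⟨n, hn⟩ hx
  exact hx n hn

/-- On test functions, `w ↦ ∫ w G` is a combination of the functionals `w ↦ ∫ w Ψ j`, because it
vanishes on their common kernel. -/
theorem exists_ae_eq_sum_of_testIntegral_eq_zero [Fintype J] (hE : Monotone E)
    (hEm : ∀ n, MeasurableSet (E n)) (hcover : ∀ᵐ x ∂ν, ∃ n, x ∈ E n) {G : Ω → ℝ}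
    {Ψ : J → Ω → ℝ} (hG : ∀ n, IntegrableOn G (E n) ν) (hΨ : ∀ j n, IntegrableOn (Ψ j) (E n) ν)
    (h : ∀ w, (∀ j, testIntegral ν hE (Ψ j) (hΨ j) w = 0) → testIntegral ν hE G hG w = 0) :
    ∃ θ : J → ℝ, G =ᵐ[ν] fun x => ∑ j, θ j * Ψ j x := by
  have hspan : testIntegral ν hE G hG ∈
      Submodule.span ℝ (Set.range fun j => testIntegral ν hE (Ψ j) (hΨ j)) :=
    mem_span_of_iInf_ker_le_ker fun w hw => h w fun j => (Submodule.mem_iInf _).1 hw j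
  obtain ⟨θ, hθ⟩ := (Submodule.mem_span_range_iff_exists_fun ℝ).1 hspan
  refine ⟨θ, ?_⟩
  have hsum : ∀ n, IntegrableOn (fun x => ∑ j, θ j * Ψ j x) (E n) ν := fun n =>
    integrable_finsetSum _ fun j _ => (hΨ j n).const_mul (θ j)
  have hzero : (fun x => G x - ∑ j, θ j * Ψ j x) =ᵐ[ν] 0 := by
    refine ae_eq_zero_of_forall_testIntegral_eq_zero hE hEm hcover
      (fun n => (hG n).sub (hsum n)) fun w => ?_
    have hw : ∀ j, Integrable (fun x => w.1 x * Ψ j x) ν :=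
      fun j => integrable_boundedTestFunction_mul w.2 (hΨ j)
    have hθw := LinearMap.congr_fun hθ w
    simp only [LinearMap.sum_apply, LinearMap.smul_apply, testIntegral, LinearMap.coe_mk,
      AddHom.coe_mk, smul_eq_mul, ← integral_const_mul] at hθw ⊢
    rw [← integral_finsetSum _ fun j _ => (hw j).const_mul (θ j)] at hθw
    simp only [mul_sub]
    rw [integral_sub (integrable_boundedTestFunction_mul w.2 hG)
      (integrable_boundedTestFunction_mul w.2 hsum), ← hθw, sub_eq_zero]
    refine integral_congr_ae (.of_forall fun x => ?_)
    simp only [Finset.mul_sum, mul_left_comm]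
  filter_upwards [hzero] with x hx
  exact sub_eq_zero.1 hx

end Multipliers

section Mixing

/-! ### Mixing the coordinates of two points -/

variable {ι X : Type*} [DecidableEq ι]

/-- Exchange the coordinates outside `s` of two points. -/
def exchangeOff (s : Finset ι) (x : (ι → X) × (ι → X)) : (ι → X) × (ι → X) :=
  (s.piecewise x.1 x.2, s.piecewise x.2 x.1)

lemma exchangeOff_exchangeOff (s : Finset ι) (x : (ι → X) × (ι → X)) :
    exchangeOff s (exchangeOff s x) = x := by
  ext i <;> by_cases h : i ∈ s <;> simp [exchangeOff, h]

lemma piecewise_exchangeOff (s : Finset ι) (x : (ι → X) × (ι → X)) :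
    s.piecewise (exchangeOff s x).1 (exchangeOff s x).2 = x.1 :=
  congrArg Prod.fst (exchangeOff_exchangeOff s x)

lemma measurable_piecewise_prod [MeasurableSpace X] (s : Finset ι) :
    Measurable fun x : (ι → X) × (ι → X) => s.piecewise x.1 x.2 := by
  refine measurable_pi_lambda _ fun i => ?_
  by_cases h : i ∈ s <;> simp only [Finset.piecewise, h, if_true, if_false] <;> fun_prop

variable [Fintype ι]

/-- The operator taking `F` to the linear combination with coefficients `c s` of its values at the
points which agree with the first argument on `s` and with the second one off `s`. -/
def mixing (c : Finset ι → ℝ) : ((ι → X) → ℝ) →ₗ[ℝ] ((ι → X) × (ι → X) → ℝ) :=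
  ∑ s, c s • LinearMap.funLeft ℝ ℝ fun x => s.piecewise x.1 x.2

lemma mixing_apply (c : Finset ι → ℝ) (F : (ι → X) → ℝ) (x : (ι → X) × (ι → X)) :
    mixing c F x = ∑ s : Finset ι, c s * F (s.piecewise x.1 x.2) := by
  simp [mixing, LinearMap.funLeft_apply]

lemma abs_mixing_le (c : Finset ι → ℝ) {F : (ι → X) → ℝ} {x : (ι → X) × (ι → X)} {B : ℝ}
    (hB : ∀ s : Finset ι, |F (s.piecewise x.1 x.2)| ≤ B) :
    |mixing c F x| ≤ (∑ s, |c s|) * B := by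
  rw [mixing_apply, Finset.sum_mul]
  refine (Finset.abs_sum_le_sum_abs _ _).trans (Finset.sum_le_sum fun s _ => ?_)
  rw [abs_mul]
  exact mul_le_mul_of_nonneg_left (hB s) (abs_nonneg _)

/-- The coefficients for which `mixing` extracts the part of a function that is not a sum of
functions of one coordinate. -/
def interactionCoeff (ι : Type*) [Fintype ι] [DecidableEq ι] : Finset ι → ℝ :=
  Pi.single Finset.univ 1 + Pi.single ∅ (Fintype.card ι - 1 : ℝ) - ∑ i, Pi.single {i} 1

lemma mixing_interactionCoeff (F : (ι → X) → ℝ) (x : (ι → X) × (ι → X)) :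
    mixing (interactionCoeff ι) F x
      = F x.1 + (Fintype.card ι - 1) * F x.2 - ∑ i, F (Function.update x.2 i (x.1 i)) := by
  simp only [mixing_apply, interactionCoeff, Pi.sub_apply, Pi.add_apply, Finset.sum_apply,
    sub_mul _ (∑ _, _), add_mul, Finset.sum_sub_distrib, Finset.sum_add_distrib, Finset.sum_mul]
  rw [Finset.sum_comm]
  simp only [Pi.single_apply, ite_mul, zero_mul, one_mul, Finset.sum_ite_eq', Finset.mem_univ,
    if_true, Finset.piecewise_univ, Finset.piecewise_empty, Finset.piecewise_singleton]

lemma mixing_interactionCoeff_coord (i : ι) (g : X → ℝ) :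
    mixing (interactionCoeff ι) (fun x => g (x i)) = 0 := by
  funext x
  have hupdate : ∀ j, g (Function.update x.2 j (x.1 j) i)
      = g (x.2 i) + if j = i then g (x.1 i) - g (x.2 i) else 0 := fun j => by
    by_cases h : j = i
    · simp [h]
    · simp [h, Ne.symm h]
  simp only [mixing_interactionCoeff, hupdate, Finset.sum_add_distrib, Finset.sum_ite_eq',
    Finset.mem_univ, if_true, Finset.sum_const, Finset.card_univ, nsmul_eq_mul, Pi.zero_apply]
  ring

lemma mixing_interactionCoeff_const (a : ℝ) :
    mixing (interactionCoeff ι) (fun _ : ι → X => a) = 0 := by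
  funext x
  simp only [mixing_interactionCoeff, Finset.sum_const, Finset.card_univ, nsmul_eq_mul,
    Pi.zero_apply]
  ring

variable [MeasurableSpace X]

lemma measurable_mixing (c : Finset ι → ℝ) {F : (ι → X) → ℝ} (hF : Measurable F) :
    Measurable (mixing c F) := by
  have : mixing c F = fun x => ∑ s : Finset ι, c s * F (s.piecewise x.1 x.2) :=
    funext (mixing_apply c F)
  rw [this]
  exact Finset.measurable_fun_sum _ fun s _ =>
    (hF.comp (measurable_piecewise_prod s)).const_mul (c s)

/-- The adjoint of `mixing c` on functions of two points, with respect to `Measure.pi μ`. -/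
noncomputable def mixingAdjoint (μ : ι → Measure X) (c : Finset ι → ℝ)
    (w : (ι → X) × (ι → X) → ℝ) (v : ι → X) : ℝ :=
  ∑ s, c s * ∫ v', w (exchangeOff s (v, v')) ∂Measure.pi μ

variable {μ : ι → Measure X}

lemma mem_of_mixingAdjoint_ne_zero {c : Finset ι → ℝ} {w : (ι → X) × (ι → X) → ℝ}
    {A : Set (ι → X)} (hA : ∀ x, w x ≠ 0 → ∀ s : Finset ι, s.piecewise x.1 x.2 ∈ A) {v : ι → X}
    (hv : mixingAdjoint μ c w v ≠ 0) : v ∈ A := by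
  by_contra hvA
  have hzero : ∀ s v', w (exchangeOff s (v, v')) = 0 := fun s v' => by
    by_contra h
    exact hvA (by simpa only [piecewise_exchangeOff] using hA _ h s)
  simp [mixingAdjoint, hzero] at hv

variable [∀ i, IsProbabilityMeasure (μ i)]

lemma measurePreserving_exchangeOff (s : Finset ι) :
    MeasurePreserving (exchangeOff s) ((Measure.pi μ).prod (Measure.pi μ))
      ((Measure.pi μ).prod (Measure.pi μ)) := by
  set e : ι → X × X → X × X := fun i => if i ∈ s then id else Prod.swap
  have he : ∀ i, MeasurePreserving (e i) ((μ i).prod (μ i)) ((μ i).prod (μ i)) := fun i => by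
    by_cases h : i ∈ s
    · simpa only [e, h, if_true] using MeasurePreserving.id _
    · simpa only [e, h, if_false] using Measure.measurePreserving_swap
  have harrow := measurePreserving_arrowProdEquivProdArrow X X ι μ μ
  have hconj : exchangeOff s = MeasurableEquiv.arrowProdEquivProdArrow X X ι ∘
      (fun a i => e i (a i)) ∘ (MeasurableEquiv.arrowProdEquivProdArrow X X ι).symm := by
    funext x
    ext i <;> by_cases h : i ∈ s <;> simp [exchangeOff, e, h,
      MeasurableEquiv.arrowProdEquivProdArrow, Equiv.arrowProdEquivProdArrow]
  rw [hconj]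
  exact harrow.comp ((measurePreserving_pi _ _ he).comp (harrow.symm _))

lemma measurePreserving_piecewise (s : Finset ι) :
    MeasurePreserving (fun x : (ι → X) × (ι → X) => s.piecewise x.1 x.2)
      ((Measure.pi μ).prod (Measure.pi μ)) (Measure.pi μ) :=
  measurePreserving_fst.comp (measurePreserving_exchangeOff s)

lemma measurable_mixingAdjoint (c : Finset ι → ℝ) {w : (ι → X) × (ι → X) → ℝ}
    (hw : Measurable w) : Measurable (mixingAdjoint μ c w) :=
  Finset.measurable_fun_sum _ fun s _ =>
    ((hw.comp (measurePreserving_exchangeOff (μ := μ) s).measurable).stronglyMeasurable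
      |>.integral_prod_right'.measurable).const_mul (c s)

lemma abs_mixingAdjoint_le (c : Finset ι → ℝ) {w : (ι → X) × (ι → X) → ℝ} {B : ℝ}
    (hB : ∀ x, |w x| ≤ B) (v : ι → X) : |mixingAdjoint μ c w v| ≤ (∑ s, |c s|) * B := by
  rw [mixingAdjoint, Finset.sum_mul]
  refine (Finset.abs_sum_le_sum_abs _ _).trans (Finset.sum_le_sum fun s _ => ?_)
  rw [abs_mul]
  refine mul_le_mul_of_nonneg_left ?_ (abs_nonneg _)
  simpa using norm_integral_le_of_norm_le_const (μ := Measure.pi μ)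
    (f := fun v' => w (exchangeOff s (v, v'))) (.of_forall fun v' => hB _)

lemma integral_mul_mixingAdjoint (c : Finset ι → ℝ) {F : (ι → X) → ℝ}
    {w : (ι → X) × (ι → X) → ℝ} (h : ∀ s : Finset ι, Integrable
      (fun x => w x * F (s.piecewise x.1 x.2)) ((Measure.pi μ).prod (Measure.pi μ))) :
    ∫ v, F v * mixingAdjoint μ c w v ∂Measure.pi μ
      = ∫ x, w x * mixing c F x ∂(Measure.pi μ).prod (Measure.pi μ) := by
  have hexch : ∀ s, Integrable (fun x => w (exchangeOff s x) * F x.1)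
      ((Measure.pi μ).prod (Measure.pi μ)) := fun s => by
    simpa only [Function.comp_def, piecewise_exchangeOff] using
      (measurePreserving_exchangeOff s).integrable_comp_of_integrable (h s)
  have hone : ∀ s, ∫ x, w (exchangeOff s x) * F x.1 ∂(Measure.pi μ).prod (Measure.pi μ)
      = ∫ x, w x * F (s.piecewise x.1 x.2) ∂(Measure.pi μ).prod (Measure.pi μ) := fun s => by
    have hmap := integral_map (measurePreserving_exchangeOff (μ := μ) s).aemeasurable
      ((measurePreserving_exchangeOff (μ := μ) s).map_eq.symm ▸ (h s).aestronglyMeasurable)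
    rw [(measurePreserving_exchangeOff s).map_eq] at hmap
    simpa only [piecewise_exchangeOff] using hmap.symm
  calc ∫ v, F v * mixingAdjoint μ c w v ∂Measure.pi μ
      = ∫ v, ∑ s, c s * ∫ v', w (exchangeOff s (v, v')) * F v ∂Measure.pi μ ∂Measure.pi μ := by
        refine integral_congr_ae (.of_forall fun v => ?_)
        simp only [mixingAdjoint, Finset.mul_sum, integral_mul_const]
        exact Finset.sum_congr rfl fun s _ => by ring
    _ = ∑ s, c s * ∫ x, w (exchangeOff s x) * F x.1 ∂(Measure.pi μ).prod (Measure.pi μ) := by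
        rw [integral_finsetSum _ fun s _ => (hexch s).integral_prod_left.const_mul (c s)]
        simp_rw [integral_const_mul, integral_prod _ (hexch _)]
    _ = ∫ x, w x * mixing c F x ∂(Measure.pi μ).prod (Measure.pi μ) := by
        simp_rw [hone, ← integral_const_mul]
        rw [← integral_finsetSum _ fun s _ => (h s).const_mul (c s)]
        refine integral_congr_ae (.of_forall fun x => ?_)
        simp only [mixing_apply, Finset.mul_sum]
        exact Finset.sum_congr rfl fun s _ => by ring

end Mixing

section MixedBounds

open Filter

variable {ι X : Type*} [DecidableEq ι] {p : (ι → X) → ℝ}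

/-- The pairs of points all of whose mixtures satisfy `1 / (n + 1) ≤ p ≤ n + 1`. -/
def mixedBounds (p : (ι → X) → ℝ) (n : ℕ) : Set ((ι → X) × (ι → X)) :=
  {x | ∀ s : Finset ι, p (s.piecewise x.1 x.2) ∈ Set.Icc ((n : ℝ) + 1)⁻¹ ((n : ℝ) + 1)⁻¹⁻¹}

lemma monotone_mixedBounds (p : (ι → X) → ℝ) : Monotone (mixedBounds p) :=
  fun m n hmn x hx s => by
    have hinv : ((n : ℝ) + 1)⁻¹ ≤ ((m : ℝ) + 1)⁻¹ := by gcongr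
    exact ⟨hinv.trans (hx s).1, (hx s).2.trans (by gcongr)⟩

variable [MeasurableSpace X]

lemma measurableSet_mixedBounds [Finite ι] (hp : Measurable p) (n : ℕ) :
    MeasurableSet (mixedBounds p n) := by
  simp only [mixedBounds, Set.ofPred_forall]
  exact MeasurableSet.iInter fun s => (hp.comp (measurable_piecewise_prod s)) measurableSet_Icc

lemma ae_exists_mem_mixedBounds [Fintype ι] {μ : ι → Measure X}
    [∀ i, IsProbabilityMeasure (μ i)] (hpos : ∀ᵐ u ∂Measure.pi μ, 0 < p u) :
    ∀ᵐ x ∂(Measure.pi μ).prod (Measure.pi μ), ∃ n, x ∈ mixedBounds p n := by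
  have hmix : ∀ᵐ x ∂(Measure.pi μ).prod (Measure.pi μ),
      ∀ s : Finset ι, 0 < p (s.piecewise x.1 x.2) :=
    ae_all_iff.2 fun s => (measurePreserving_piecewise s).quasiMeasurePreserving.ae hpos
  filter_upwards [hmix] with x hx
  suffices ∀ᶠ n : ℕ in atTop, x ∈ mixedBounds p n from this.exists
  refine eventually_all.2 fun s => ?_
  have hlim : Tendsto (fun n : ℕ => (n : ℝ) + 1) atTop atTop :=
    tendsto_natCast_atTop_atTop.atTop_add tendsto_const_nhds
  filter_upwards [hlim.inv_tendsto_atTop.eventually (ge_mem_nhds (hx s)),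
    hlim.eventually_ge_atTop (p (s.piecewise x.1 x.2))] with n hlow hupp
  exact ⟨hlow, by rwa [inv_inv]⟩

end MixedBounds

section CouplingDensities

/-! ### Entropy minimizers among couplings -/

open Filter Topology

variable {ι X J : Type*} [MeasurableSpace X]

/-- The indicators of measurable sets of one coordinate, whose expectations determine the marginals
of a distribution on `ι → X`, followed by the functions `φ j`. -/
noncomputable def couplingTests (φ : J → (ι → X) → ℝ) :
    (ι × {A : Set X // MeasurableSet A}) ⊕ J → (ι → X) → ℝ :=
  Sum.elim (fun k x => k.2.1.indicator 1 (x k.1)) φ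

lemma measurable_couplingTests {φ : J → (ι → X) → ℝ} (hφ : ∀ j, Measurable (φ j)) :
    ∀ k, Measurable (couplingTests φ k)
  | .inl k => (measurable_one.indicator k.2.2).comp (measurable_pi_apply k.1)
  | .inr j => hφ j

lemma exists_abs_couplingTests_le {φ : J → (ι → X) → ℝ} (hC : ∀ j, ∃ C, ∀ x, |φ j x| ≤ C) :
    ∀ k, ∃ C, ∀ x, |couplingTests φ k x| ≤ C
  | .inl k => ⟨1, fun x => by
      by_cases h : x k.1 ∈ k.2.1 <;> simp [couplingTests, h]⟩
  | .inr j => hC j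

variable [Fintype ι]

/-- The densities, with respect to the product of the `μ i`, of the distributions with marginals
`μ i` under which each `φ j` has expectation `α j`. -/
def couplingDensities (μ : ι → Measure X) (φ : J → (ι → X) → ℝ) (α : J → ℝ) :
    Set ((ι → X) → ℝ) :=
  momentDensities (Measure.pi μ) (couplingTests φ) (Sum.elim (fun k => (μ k.1).real k.2.1) α)

variable {μ : ι → Measure X} [∀ i, IsProbabilityMeasure (μ i)]
  {φ : J → (ι → X) → ℝ} {α : J → ℝ} {p : (ι → X) → ℝ}

/-- The first variation of the entropy in the direction `mixingAdjoint μ (interactionCoeff ι) w`,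
which keeps the marginals because `mixing (interactionCoeff ι)` kills functions of one
coordinate. -/
lemma IsEntropyMinimizer.integral_mul_mixing_log_eq_zero [DecidableEq ι]
    (hφ : ∀ j, Measurable (φ j)) (hC : ∀ j, ∃ C, ∀ x, |φ j x| ≤ C)
    (hp : IsEntropyMinimizer (Measure.pi μ) (couplingDensities μ φ α) p)
    {w : (ι → X) × (ι → X) → ℝ} (hw : Measurable w) {B ε : ℝ} (hB : ∀ x, |w x| ≤ B) (hε : 0 < ε)
    (hsupp : ∀ x, w x ≠ 0 → ∀ s : Finset ι, p (s.piecewise x.1 x.2) ∈ Set.Icc ε ε⁻¹)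
    (horth : ∀ j, ∫ x, w x * mixing (interactionCoeff ι) (φ j) x
      ∂(Measure.pi μ).prod (Measure.pi μ) = 0) :
    ∫ x, w x * mixing (interactionCoeff ι) (fun u => Real.log (p u)) x
      ∂(Measure.pi μ).prod (Measure.pi μ) = 0 := by
  set κ := mixingAdjoint μ (interactionCoeff ι) w
  have hpm : Measurable p := hp.mem.1.measurable
  have hwi : Integrable w ((Measure.pi μ).prod (Measure.pi μ)) :=
    .of_bound hw.aestronglyMeasurable B (.of_forall hB)
  have hdual : ∀ F : (ι → X) → ℝ, Measurable F → (∃ C, ∀ u, |F u| ≤ C) →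
      ∫ v, F v * κ v ∂Measure.pi μ = ∫ x, w x * mixing (interactionCoeff ι) F x
        ∂(Measure.pi μ).prod (Measure.pi μ) := fun F hF ⟨C, hFC⟩ =>
    integral_mul_mixingAdjoint _ fun s => by
      simpa only [mul_comm, Function.comp_def] using integrable_mul_of_abs_le
        (hF.comp (measurable_piecewise_prod s)) ⟨C, fun x => hFC _⟩ hwi
  have hκsupp : ∀ v, κ v ≠ 0 → p v ∈ Set.Icc ε ε⁻¹ := fun v hv =>
    mem_of_mixingAdjoint_ne_zero (A := p ⁻¹' Set.Icc ε ε⁻¹) hsupp hv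
  have hκ1 : ∫ v, κ v ∂Measure.pi μ = 0 := by
    simpa [mixing_interactionCoeff_const] using hdual (fun _ => 1) measurable_const ⟨1, by simp⟩
  have hκψ : ∀ k, ∫ v, couplingTests φ k v * κ v ∂Measure.pi μ = 0 := fun k => by
    rw [hdual _ (measurable_couplingTests hφ k) (exists_abs_couplingTests_le hC k)]
    rcases k with k | j
    · simp [couplingTests, mixing_interactionCoeff_coord]
    · exact horth j
  have hκm : Measurable κ := measurable_mixingAdjoint _ hw
  have hκB := abs_mixingAdjoint_le (μ := μ) (interactionCoeff ι) hB
  have hlog := hp.integral_mul_log_eq_zero (fun _ h => h.1) hκm hε hκB hκsupp <|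
    eventually_add_smul_mem_momentDensities (measurable_couplingTests hφ)
      (exists_abs_couplingTests_le hC) hp.mem hκm hε hκB (fun v hv => (hκsupp v hv).1) hκ1 hκψ
  rw [← integral_mul_mixingAdjoint _ fun s => integrable_mul_log_of_mem_Icc
    (hpm.comp (measurable_piecewise_prod s)) hw hε hB fun x hx => hsupp x hx s, ← hlog]
  simp only [κ, mul_comm]

theorem IsEntropyMinimizer.exists_mixing_log_ae_eq [DecidableEq ι] [Fintype J]
    (hφ : ∀ j, Measurable (φ j)) (hC : ∀ j, ∃ C, ∀ x, |φ j x| ≤ C)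
    (hp : IsEntropyMinimizer (Measure.pi μ) (couplingDensities μ φ α) p)
    (hpos : ∀ᵐ u ∂Measure.pi μ, 0 < p u) :
    ∃ θ : J → ℝ, mixing (interactionCoeff ι) (fun u => Real.log (p u))
      =ᵐ[(Measure.pi μ).prod (Measure.pi μ)]
        fun x => ∑ j, θ j * mixing (interactionCoeff ι) (φ j) x := by
  have hpm : Measurable p := hp.mem.1.measurable
  have hEm := measurableSet_mixedBounds hpm
  have hint : ∀ n, ∀ F : (ι → X) → ℝ, Measurable F →
      (∃ B, ∀ x ∈ mixedBounds p n, ∀ s : Finset ι, |F (s.piecewise x.1 x.2)| ≤ B) →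
      IntegrableOn (mixing (interactionCoeff ι) F) (mixedBounds p n)
        ((Measure.pi μ).prod (Measure.pi μ)) := fun n F hF ⟨B, hB⟩ =>
    .of_bound (measure_lt_top _ _) (measurable_mixing _ hF).aestronglyMeasurable _
      ((ae_restrict_iff' (hEm n)).2 (.of_forall fun x hx => abs_mixing_le _ (hB x hx)))
  refine exists_ae_eq_sum_of_testIntegral_eq_zero (monotone_mixedBounds p) hEm
    (ae_exists_mem_mixedBounds hpos)
    (fun n => hint n _ (Real.measurable_log.comp hpm) ⟨_, fun x hx s =>
      abs_log_le_of_mem_Icc_inv (by positivity) (hx s)⟩)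
    (fun j n => hint n _ (hφ j) <| (hC j).imp fun _ h _ _ _ => h _) ?_
  rintro ⟨w, hw, ⟨B, hB⟩, n, hn⟩ horth
  exact hp.integral_mul_mixing_log_eq_zero hφ hC hw hB (by positivity)
    (fun x hx => by_contra fun h => hx (hn x h)) horth

/-- The coordinate functions come from freezing the second point at a generic `a`. -/
lemma exists_ae_eq_sum_coord_of_mixing_ae_eq_zero [DecidableEq ι] [Nonempty ι]
    {G : (ι → X) → ℝ} (hG : Measurable G)
    (h : mixing (interactionCoeff ι) G =ᵐ[(Measure.pi μ).prod (Measure.pi μ)] 0) :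
    ∃ g : ι → X → ℝ, (∀ i, Measurable (g i)) ∧ G =ᵐ[Measure.pi μ] fun u => ∑ i, g i (u i) := by
  have hswap : ∀ᵐ x ∂(Measure.pi μ).prod (Measure.pi μ),
      mixing (interactionCoeff ι) G x.swap = 0 :=
    Measure.measurePreserving_swap.quasiMeasurePreserving.ae h
  obtain ⟨a, ha⟩ := (Measure.ae_ae_of_ae_prod hswap).exists
  refine ⟨fun i t => G (Function.update a i t)
    - (Fintype.card ι - 1 : ℝ) * G a / Fintype.card ι,
    fun i => (hG.comp (measurable_update a)).sub_const _, ?_⟩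
  filter_upwards [ha] with u hu
  rw [mixing_interactionCoeff, Prod.swap_prod_mk] at hu
  rw [Finset.sum_sub_distrib, Finset.sum_const, Finset.card_univ, nsmul_eq_mul,
    mul_div_cancel₀ _ (Nat.cast_ne_zero.2 Fintype.card_ne_zero)]
  linarith

theorem IsEntropyMinimizer.exists_log_ae_eq_sum [Fintype J]
    (hφ : ∀ j, Measurable (φ j)) (hC : ∀ j, ∃ C, ∀ x, |φ j x| ≤ C)
    (hp : IsEntropyMinimizer (Measure.pi μ) (couplingDensities μ φ α) p)
    (hpos : ∀ᵐ u ∂Measure.pi μ, 0 < p u) :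
    ∃ (θ : J → ℝ) (g : ι → X → ℝ), (∀ i, Measurable (g i)) ∧ (fun u => Real.log (p u))
      =ᵐ[Measure.pi μ] fun u => ∑ j, θ j * φ j u + ∑ i, g i (u i) := by
  classical
  cases isEmpty_or_nonempty ι
  · refine ⟨0, isEmptyElim, isEmptyElim, .of_forall fun u => ?_⟩
    simp [hp.mem.1.eq_one_of_subsingleton u]
  obtain ⟨θ, hθ⟩ := hp.exists_mixing_log_ae_eq hφ hC hpos
  have hresidual : mixing (interactionCoeff ι) ((fun u => Real.log (p u)) - ∑ j, θ j • φ j)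
      =ᵐ[(Measure.pi μ).prod (Measure.pi μ)] 0 := by
    filter_upwards [hθ] with x hx
    simp [hx]
  have hmeas : Measurable ((fun u => Real.log (p u)) - ∑ j, θ j • φ j) := by
    rw [Finset.sum_fn]
    exact (Real.measurable_log.comp hp.mem.1.measurable).sub
      (Finset.measurable_sum _ fun j _ => (hφ j).const_smul (θ j))
  obtain ⟨g, hg, hsum⟩ := exists_ae_eq_sum_coord_of_mixing_ae_eq_zero hmeas hresidual
  refine ⟨θ, g, hg, ?_⟩
  filter_upwards [hsum] with u hu
  simp only [Pi.sub_apply, Finset.sum_apply, Pi.smul_apply, smul_eq_mul] at hu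
  linarith

end CouplingDensities

section ProductDensities

/-! ### Densities of product form -/

lemma ae_le_of_withDensity_le {Ω : Type*} [MeasurableSpace Ω] {μ : Measure Ω} [SigmaFinite μ]
    {f g : Ω → ENNReal} (hf : Measurable f) (h : μ.withDensity f ≤ μ.withDensity g) :
    f ≤ᵐ[μ] g :=
  ae_le_of_forall_setLIntegral_le_of_sigmaFinite hf fun s hs _ => by
    simpa only [withDensity_apply _ hs] using h s

variable {ι X : Type*} [Fintype ι] [MeasurableSpace X] {μ : ι → Measure X}
  [∀ i, IsProbabilityMeasure (μ i)]

lemma lintegral_pi_prod_eq_prod_lintegral {H : ι → X → ENNReal} (hH : ∀ i, Measurable (H i)) :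
    ∫⁻ u, ∏ i, H i (u i) ∂Measure.pi μ = ∏ i, ∫⁻ t, H i t ∂μ i := by
  rw [ProbabilityTheory.lintegral_prod_eq_prod_lintegral_of_indepFun Finset.univ
    (fun i (u : ι → X) => H i (u i))
    (ProbabilityTheory.iIndepFun_pi fun i => (hH i).aemeasurable)
    fun i => (hH i).comp (measurable_pi_apply i)]
  exact Finset.prod_congr rfl fun i _ => (measurePreserving_eval μ i).lintegral_comp (hH i)

lemma withDensity_prod_eq_pi_withDensity {H : ι → X → ENNReal} (hH : ∀ i, Measurable (H i))
    [∀ i, SigmaFinite ((μ i).withDensity (H i))] :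
    (Measure.pi μ).withDensity (fun u => ∏ i, H i (u i))
      = Measure.pi fun i => (μ i).withDensity (H i) := by
  refine (Measure.pi_eq fun s hs => ?_).symm
  have hindicator : (Set.univ.pi s).indicator (fun u => ∏ i, H i (u i))
      = fun u => ∏ i, (s i).indicator (H i) (u i) := by
    funext u
    by_cases hu : u ∈ Set.univ.pi s
    · rw [Set.indicator_of_mem hu]
      exact Finset.prod_congr rfl fun i _ => (Set.indicator_of_mem (hu i trivial) _).symm
    · obtain ⟨i, hi⟩ : ∃ i, u i ∉ s i := by simpa [Set.mem_univ_pi] using hu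
      rw [Set.indicator_of_notMem hu,
        Finset.prod_eq_zero (Finset.mem_univ i) (Set.indicator_of_notMem hi _)]
  rw [withDensity_apply _ (.univ_pi hs), ← lintegral_indicator (.univ_pi hs), hindicator,
    lintegral_pi_prod_eq_prod_lintegral fun i => (hH i).indicator (hs i)]
  exact Finset.prod_congr rfl fun i _ => by
    rw [withDensity_apply _ (hs i), lintegral_indicator (hs i)]

lemma exists_map_eval_withDensity_exp_sum_eq {g : ι → X → ℝ} (hg : ∀ i, Measurable (g i))
    (i : ι) : ∃ r : ENNReal,
      ((Measure.pi μ).withDensity fun u => ENNReal.ofReal (Real.exp (∑ j, g j (u j)))).map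
        (fun u => u i) = (μ i).withDensity fun t => r * ENNReal.ofReal (Real.exp (g i t)) := by
  classical
  have hexp : ∀ j, Measurable fun t => ENNReal.ofReal (Real.exp (g j t)) :=
    fun j => (Real.measurable_exp.comp (hg j)).ennreal_ofReal
  have hσ : ∀ j, SigmaFinite ((μ j).withDensity fun t => ENNReal.ofReal (Real.exp (g j t))) :=
    fun j => inferInstance
  refine ⟨∏ j ∈ Finset.univ.erase i,
    (μ j).withDensity (fun t => ENNReal.ofReal (Real.exp (g j t))) Set.univ, ?_⟩
  simp only [Real.exp_sum, ENNReal.ofReal_prod_of_nonneg fun _ _ => (Real.exp_pos _).le]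
  rw [withDensity_prod_eq_pi_withDensity hexp]
  exact (Measure.pi_map_eval _ i).trans (withDensity_smul _ (hexp i)).symm

lemma abs_le_of_mul_exp_le {r : ENNReal} {x B : ℝ}
    (hupp : r * ENNReal.ofReal (Real.exp x) ≤ ENNReal.ofReal (Real.exp B))
    (hlow : 1 ≤ ENNReal.ofReal (Real.exp B) * (r * ENNReal.ofReal (Real.exp x))) :
    |x| ≤ B + |Real.log r.toReal| := by
  have hr0 : r ≠ 0 := by
    rintro rfl
    simp at hlow
  have hr : r ≠ ⊤ := by
    rintro rfl
    simp [ENNReal.top_mul, Real.exp_pos] at hupp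
  have hpos : 0 < r.toReal := ENNReal.toReal_pos hr0 hr
  have hconv : r * ENNReal.ofReal (Real.exp x)
      = ENNReal.ofReal (Real.exp (Real.log r.toReal + x)) := by
    rw [Real.exp_add, Real.exp_log hpos, ENNReal.ofReal_mul hpos.le, ENNReal.ofReal_toReal hr]
  rw [hconv, ENNReal.ofReal_le_ofReal_iff (Real.exp_pos _).le, Real.exp_le_exp] at hupp
  rw [hconv, ← ENNReal.ofReal_mul (Real.exp_pos _).le, ← Real.exp_add, ENNReal.one_le_ofReal,
    Real.one_le_exp_iff] at hlow
  exact abs_le.2 ⟨by linarith [le_abs_self (Real.log r.toReal)],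
    by linarith [neg_abs_le (Real.log r.toReal)]⟩

theorem exists_ae_abs_le_of_map_eval_eq {E : (ι → X) → ℝ} {g : ι → X → ℝ} {B : ℝ}
    (hB : ∀ u, |E u| ≤ B) (hg : ∀ i, Measurable (g i)) {i : ι}
    (hmarg : ((Measure.pi μ).withDensity fun u =>
      ENNReal.ofReal (Real.exp (E u + ∑ j, g j (u j)))).map (fun u => u i) = μ i) :
    ∃ M, ∀ᵐ t ∂μ i, |g i t| ≤ M := by
  set C := ENNReal.ofReal (Real.exp B)
  set S : (ι → X) → ENNReal := fun u => ENNReal.ofReal (Real.exp (∑ j, g j (u j)))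
  set D : (ι → X) → ENNReal := fun u => ENNReal.ofReal (Real.exp (E u + ∑ j, g j (u j)))
  have hDS : ∀ u, D u ≤ C * S u := fun u => by
    rw [← ENNReal.ofReal_mul (Real.exp_pos B).le, ← Real.exp_add]
    exact ENNReal.ofReal_le_ofReal (Real.exp_le_exp.2 (by linarith [(abs_le.1 (hB u)).2]))
  have hSD : ∀ u, S u ≤ C * D u := fun u => by
    rw [← ENNReal.ofReal_mul (Real.exp_pos B).le, ← Real.exp_add]
    exact ENNReal.ofReal_le_ofReal (Real.exp_le_exp.2 (by linarith [(abs_le.1 (hB u)).1]))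
  have hle : ∀ {F G : (ι → X) → ENNReal}, (∀ u, F u ≤ C * G u) →
      ((Measure.pi μ).withDensity F).map (fun u => u i)
        ≤ C • ((Measure.pi μ).withDensity G).map (fun u => u i) := fun h => by
    rw [← Measure.map_smul, ← withDensity_smul' _ _ ENNReal.ofReal_ne_top]
    exact Measure.map_mono (withDensity_mono (.of_forall h)) (measurable_pi_apply i)
  obtain ⟨r, hr⟩ := exists_map_eval_withDensity_exp_sum_eq (μ := μ) hg i
  have hrm : Measurable fun t => r * ENNReal.ofReal (Real.exp (g i t)) :=
    (Real.measurable_exp.comp (hg i)).ennreal_ofReal.const_mul r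
  have hupp := hle hSD
  have hlow := hle hDS
  rw [hr, hmarg, ← withDensity_const] at hupp
  rw [hr, hmarg, ← withDensity_smul _ hrm] at hlow
  nth_rw 1 [← withDensity_one (μ := μ i)] at hlow
  refine ⟨B + |Real.log r.toReal|, ?_⟩
  filter_upwards [ae_le_of_withDensity_le hrm hupp, ae_le_of_withDensity_le measurable_one hlow]
    with t using abs_le_of_mul_exp_le

end ProductDensities

section RelativeEntropy

/-! ### Relative entropy of probability densities -/

variable {Ω : Type*} [MeasurableSpace Ω] {μ P Q : Measure Ω} {p : Ω → ℝ}

lemma withDensity_ofReal_toReal_rnDeriv [SigmaFinite P] [SigmaFinite μ] (hP : P ≪ μ) :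
    μ.withDensity (fun x => ENNReal.ofReal (P.rnDeriv μ x).toReal) = P := by
  conv_rhs => rw [← Measure.withDensity_rnDeriv_eq P μ hP]
  refine withDensity_congr_ae ?_
  filter_upwards [Measure.rnDeriv_lt_top P μ] with x hx
  exact ENNReal.ofReal_toReal hx.ne

lemma toReal_rnDeriv_withDensity_ofReal [SigmaFinite μ] (hp : Measurable p) (hp0 : ∀ x, 0 ≤ p x) :
    (fun x => ((μ.withDensity fun x => ENNReal.ofReal (p x)).rnDeriv μ x).toReal) =ᵐ[μ] p := by
  filter_upwards [Measure.rnDeriv_withDensity μ hp.ennreal_ofReal] with x hx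
  rw [hx, ENNReal.toReal_ofReal (hp0 x)]

lemma isProbDensity_toReal_rnDeriv [IsProbabilityMeasure P] [SigmaFinite μ] (hP : P ≪ μ) :
    IsProbDensity μ fun x => (P.rnDeriv μ x).toReal :=
  ⟨(Measure.measurable_rnDeriv P μ).ennreal_toReal, fun _ => ENNReal.toReal_nonneg,
    Measure.integrable_toReal_rnDeriv, (Measure.integral_toReal_rnDeriv hP).trans probReal_univ⟩

lemma IsProbDensity.lintegral_ofReal_eq_one (hp : IsProbDensity μ p) :
    ∫⁻ x, ENNReal.ofReal (p x) ∂μ = 1 := by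
  rw [← ofReal_integral_eq_lintegral_ofReal hp.integrable (.of_forall hp.nonneg),
    hp.integral_eq_one, ENNReal.ofReal_one]

lemma IsProbDensity.isProbabilityMeasure_withDensity (hp : IsProbDensity μ p) :
    IsProbabilityMeasure (μ.withDensity fun x => ENNReal.ofReal (p x)) :=
  ⟨by rw [withDensity_apply _ .univ, Measure.restrict_univ, hp.lintegral_ofReal_eq_one]⟩

lemma IsProbDensity.integral_withDensity (hp : IsProbDensity μ p) (g : Ω → ℝ) :
    ∫ x, g x ∂(μ.withDensity fun x => ENNReal.ofReal (p x)) = ∫ x, g x * p x ∂μ := by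
  rw [integral_withDensity_eq_integral_toReal_smul hp.measurable.ennreal_ofReal
    (.of_forall fun _ => ENNReal.ofReal_lt_top)]
  simp only [ENNReal.toReal_ofReal (hp.nonneg _), smul_eq_mul, mul_comm]

lemma IsEntropyMinimizer.of_ae_eq {𝒟 : Set (Ω → ℝ)} {p' : Ω → ℝ} (hp : IsEntropyMinimizer μ 𝒟 p)
    (hp' : p' ∈ 𝒟) (h : p =ᵐ[μ] p') : IsEntropyMinimizer μ 𝒟 p' where
  mem := hp'
  integrable := hp.integrable.congr (h.fun_comp klFun)
  le f hf hfint := integral_congr_ae (h.fun_comp klFun) ▸ hp.le f hf hfint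

lemma IsProbDensity.lintegral_klFun_ne_top_iff (hp : IsProbDensity μ p) :
    ∫⁻ x, ENNReal.ofReal (klFun (p x)) ∂μ ≠ ⊤ ↔ Integrable (fun x => klFun (p x)) μ :=
  lintegral_ofReal_ne_top_iff_integrable
    (measurable_klFun.comp hp.measurable).aestronglyMeasurable
    (.of_forall fun x => klFun_nonneg (hp.nonneg x))

lemma isEntropyMinimizer_iff_lintegral_le {𝒟 : Set (Ω → ℝ)}
    (hdens : ∀ p ∈ 𝒟, IsProbDensity μ p) (hp : p ∈ 𝒟) :
    IsEntropyMinimizer μ 𝒟 p ↔ ∫⁻ x, ENNReal.ofReal (klFun (p x)) ∂μ ≠ ⊤ ∧ ∀ p' ∈ 𝒟,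
      ∫⁻ x, ENNReal.ofReal (klFun (p x)) ∂μ ≤ ∫⁻ x, ENNReal.ofReal (klFun (p' x)) ∂μ := by
  have hle : ∀ f ∈ 𝒟, Integrable (fun x => klFun (p x)) μ → Integrable (fun x => klFun (f x)) μ →
      (∫⁻ x, ENNReal.ofReal (klFun (p x)) ∂μ ≤ ∫⁻ x, ENNReal.ofReal (klFun (f x)) ∂μ ↔
        ∫ x, klFun (p x) ∂μ ≤ ∫ x, klFun (f x) ∂μ) := fun f hf hpint hfint => by
    rw [← ofReal_integral_eq_lintegral_ofReal hpint
        (.of_forall fun x => klFun_nonneg ((hdens p hp).nonneg x)),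
      ← ofReal_integral_eq_lintegral_ofReal hfint
        (.of_forall fun x => klFun_nonneg ((hdens f hf).nonneg x)),
      ENNReal.ofReal_le_ofReal_iff (hdens f hf).integral_klFun_nonneg]
  rw [(hdens p hp).lintegral_klFun_ne_top_iff]
  refine ⟨fun h => ⟨h.integrable, fun f hf => ?_⟩, fun ⟨hpint, h⟩ =>
    ⟨hp, hpint, fun f hf hfint => (hle f hf hpint hfint).1 (h f hf)⟩⟩
  by_cases hfint : Integrable (fun x => klFun (f x)) μ
  · exact (hle f hf h.integrable hfint).2 (h.le f hf hfint)
  · exact not_ne_iff.1 (mt (hdens f hf).lintegral_klFun_ne_top_iff.1 hfint) ▸ le_top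

lemma ofReal_klFun_add_ofReal_negMulLog {x : ℝ} (hx : 0 ≤ x) :
    ENNReal.ofReal (klFun x) + ENNReal.ofReal (Real.negMulLog x) + ENNReal.ofReal x
      = ENNReal.ofReal (-Real.negMulLog x) + 1 := by
  have hkl : klFun x = 1 - x - Real.negMulLog x := by
    rw [klFun_apply, Real.negMulLog]
    ring
  rw [← ENNReal.ofReal_one, add_right_comm, ← ENNReal.ofReal_add (klFun_nonneg hx) hx, hkl]
  rcases le_total 0 (Real.negMulLog x) with h | h
  · rw [ENNReal.ofReal_of_nonpos (neg_nonpos.2 h), zero_add,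
      ← ENNReal.ofReal_add (by linarith [hkl ▸ klFun_nonneg hx]) h]
    congr 1
    ring
  · rw [ENNReal.ofReal_of_nonpos h, add_zero, ← ENNReal.ofReal_add (neg_nonneg.2 h) zero_le_one]
    congr 1
    ring

lemma IsProbDensity.lintegral_klFun_add_negMulLog [IsProbabilityMeasure μ]
    (hp : IsProbDensity μ p) :
    ∫⁻ x, ENNReal.ofReal (klFun (p x)) ∂μ + ∫⁻ x, ENNReal.ofReal (Real.negMulLog (p x)) ∂μ
      = ∫⁻ x, ENNReal.ofReal (-Real.negMulLog (p x)) ∂μ := by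
  have hint := lintegral_congr (μ := μ) fun x => ofReal_klFun_add_ofReal_negMulLog (hp.nonneg x)
  have hklm : Measurable fun x => ENNReal.ofReal (klFun (p x)) :=
    (measurable_klFun.comp hp.measurable).ennreal_ofReal
  rw [lintegral_add_right _ hp.measurable.ennreal_ofReal, lintegral_add_right _ measurable_const,
    lintegral_add_left hklm, hp.lintegral_ofReal_eq_one, lintegral_one, measure_univ] at hint
  exact (ENNReal.add_left_inj ENNReal.one_ne_top).1 hint

lemma IsProbDensity.lintegral_negMulLog_ne_top [IsProbabilityMeasure μ]
    (hp : IsProbDensity μ p) : ∫⁻ x, ENNReal.ofReal (Real.negMulLog (p x)) ∂μ ≠ ⊤ := by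
  have hle : ∫⁻ x, ENNReal.ofReal (Real.negMulLog (p x)) ∂μ ≤ ∫⁻ _, 1 ∂μ :=
    lintegral_mono fun x => ENNReal.ofReal_le_one.2 <|
      (Real.negMulLog_le_one_sub_self (hp.nonneg x)).trans (sub_le_self 1 (hp.nonneg x))
  exact ne_top_of_le_ne_top (by simp) hle

lemma llr_add_llr [SigmaFinite P] [SigmaFinite Q] [SigmaFinite μ] (hPQ : P ≪ Q) (hQμ : Q ≪ μ) :
    (fun x => llr P Q x + llr Q μ x) =ᵐ[P] llr P μ := by
  have hpos : ∀ {P' Q' : Measure Ω} [SigmaFinite P'] [SigmaFinite Q'], P' ≪ Q' →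
      ∀ᵐ x ∂P', 0 < (P'.rnDeriv Q' x).toReal := fun {P' Q'} _ _ h => by
    filter_upwards [Measure.rnDeriv_pos h, h.ae_le (Measure.rnDeriv_ne_top P' Q')] with x h0 htop
    exact ENNReal.toReal_pos h0.ne' htop
  filter_upwards [(hPQ.trans hQμ).ae_le (Measure.rnDeriv_mul_rnDeriv (κ := μ) hPQ),
    hpos hPQ, hPQ.ae_le (hpos hQμ)] with x hmul hPQx hQμx
  rw [llr, llr, llr, ← Real.log_mul hPQx.ne' hQμx.ne', ← ENNReal.toReal_mul, ← hmul, Pi.mul_apply]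

theorem klDiv_add_klDiv_of_integral_llr_eq [IsFiniteMeasure P] [IsFiniteMeasure Q]
    [IsFiniteMeasure μ] (hPQ : P ≪ Q) (hQμ : Q ≪ μ) (hP : Integrable (llr Q μ) P)
    (hQ : Integrable (llr Q μ) Q) (heq : ∫ x, llr Q μ x ∂P = ∫ x, llr Q μ x ∂Q) :
    klDiv P Q + klDiv Q μ = klDiv P μ := by
  have hchain := llr_add_llr hPQ hQμ
  by_cases hPQi : Integrable (llr P Q) P
  · have hPμi : Integrable (llr P μ) P := (hPQi.add hP).congr hchain
    rw [klDiv_of_ac_of_integrable hPQ hPQi, klDiv_of_ac_of_integrable hQμ hQ,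
      klDiv_of_ac_of_integrable (hPQ.trans hQμ) hPμi,
      ← ENNReal.ofReal_add (integral_llr_add_sub_measure_univ_nonneg hPQ hPQi)
        (integral_llr_add_sub_measure_univ_nonneg hQμ hQ),
      ← integral_congr_ae hchain, integral_add hPQi hP, heq]
    congr 1
    ring
  · have hPμi : ¬Integrable (llr P μ) P := fun h => hPQi <| (h.sub hP).congr <| by
      filter_upwards [hchain] with x hx
      rw [Pi.sub_apply, ← hx, add_sub_cancel_right]
    rw [klDiv_of_not_integrable hPQi, klDiv_of_not_integrable hPμi, top_add]

lemma llr_withDensity_ofReal_exp [SigmaFinite μ] {ℓ : Ω → ℝ} (hℓ : AEMeasurable ℓ μ) :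
    llr (μ.withDensity fun x => ENNReal.ofReal (Real.exp (ℓ x))) μ =ᵐ[μ] ℓ := by
  have hexp : AEMeasurable (fun x => ENNReal.ofReal (Real.exp (ℓ x))) μ :=
    (Real.measurable_exp.comp_aemeasurable hℓ).ennreal_ofReal
  filter_upwards [Measure.rnDeriv_withDensity₀ μ hexp] with x hx
  rw [llr, hx, ENNReal.toReal_ofReal (Real.exp_pos _).le, Real.log_exp]

theorem klDiv_add_klDiv_of_eq_withDensity_exp [IsFiniteMeasure P] [IsFiniteMeasure Q]
    [IsFiniteMeasure μ] {ℓ : Ω → ℝ} (hPμ : P ≪ μ) (hℓ : AEMeasurable ℓ μ)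
    (hQ : Q = μ.withDensity fun x => ENNReal.ofReal (Real.exp (ℓ x)))
    (hℓP : Integrable ℓ P) (hℓQ : Integrable ℓ Q) (heq : ∫ x, ℓ x ∂P = ∫ x, ℓ x ∂Q) :
    klDiv Q μ ≠ ⊤ ∧ klDiv P Q + klDiv Q μ = klDiv P μ := by
  have hQμ : Q ≪ μ := hQ ▸ withDensity_absolutelyContinuous _ _
  have hμQ : μ ≪ Q := hQ ▸ withDensity_absolutelyContinuous'
    (Real.measurable_exp.comp_aemeasurable hℓ).ennreal_ofReal
    (.of_forall fun x => (ENNReal.ofReal_pos.2 (Real.exp_pos (ℓ x))).ne')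
  have hllr : llr Q μ =ᵐ[μ] ℓ := hQ ▸ llr_withDensity_ofReal_exp hℓ
  have hllrP : llr Q μ =ᵐ[P] ℓ := hPμ.ae_le hllr
  have hllrQ : llr Q μ =ᵐ[Q] ℓ := hQμ.ae_le hllr
  have hintQ := hℓQ.congr hllrQ.symm
  exact ⟨klDiv_ne_top hQμ hintQ, klDiv_add_klDiv_of_integral_llr_eq (hPμ.trans hμQ) hQμ
    (hℓP.congr hllrP.symm) hintQ
    (by rw [integral_congr_ae hllrP, heq, integral_congr_ae hllrQ])⟩

end RelativeEntropy

section Copula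

/-! ### Copulas with a density -/

variable {d q : ℕ} {φ : Cube d → Fin q → ℝ} {α : Fin q → ℝ} {P Q : Measure (Cube d)}

lemma withDensity_pdfOf (hP : P ∈ copulasWithPdf d) :
    volume.withDensity (fun u => ENNReal.ofReal (pdfOf P u)) = P :=
  have := hP.1
  withDensity_ofReal_toReal_rnDeriv hP.2.1

lemma pdfOf_withDensity {p : Cube d → ℝ} (hp : IsProbDensity volume p) :
    pdfOf (volume.withDensity fun u => ENNReal.ofReal (p u)) =ᵐ[volume] p :=
  toReal_rnDeriv_withDensity_ofReal hp.measurable hp.nonneg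

lemma isProbDensity_pdfOf (hP : P ∈ copulasWithPdf d) : IsProbDensity volume (pdfOf P) :=
  have := hP.1
  isProbDensity_toReal_rnDeriv hP.2.1

lemma measurePreserving_eval_of_mem_copulasWithPdf (hP : P ∈ copulasWithPdf d) (i : Fin d) :
    MeasurePreserving (fun u : Cube d => u i) P volume :=
  ⟨measurable_pi_apply i, hP.2.2 i⟩

lemma klDiv_volume_eq_lintegral_klFun_pdfOf (hP : P ∈ copulasWithPdf d) :
    klDiv P volume = ∫⁻ u, ENNReal.ofReal (klFun (pdfOf P u)) :=
  have := hP.1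
  klDiv_eq_lintegral_klFun_of_ac hP.2.1

theorem diffEntropy_eq_neg_klDiv (hP : P ∈ copulasWithPdf d) :
    diffEntropy P = -((klDiv P volume : ENNReal) : EReal) := by
  have hp := isProbDensity_pdfOf hP
  have hH : ((_ : ℝ) : EReal) = _ := EReal.coe_ennreal_toReal hp.lintegral_negMulLog_ne_top
  rw [diffEntropy, ← hp.lintegral_klFun_add_negMulLog,
    ← klDiv_volume_eq_lintegral_klFun_pdfOf hP, EReal.coe_ennreal_add, ← hH, sub_eq_add_neg,
    EReal.neg_add (.inr (EReal.coe_ne_top _)) (.inr (EReal.coe_ne_bot _)), add_comm,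
    EReal.sub_add_cancel]

lemma diffEntropy_le_iff_klDiv_le (hP : P ∈ copulasWithPdf d) (hQ : Q ∈ copulasWithPdf d) :
    diffEntropy P ≤ diffEntropy Q ↔ klDiv Q volume ≤ klDiv P volume := by
  rw [diffEntropy_eq_neg_klDiv hP, diffEntropy_eq_neg_klDiv hQ, EReal.neg_le_neg_iff,
    EReal.coe_ennreal_le_coe_ennreal_iff]

lemma HasFiniteEntropy.klDiv_ne_top (h : HasFiniteEntropy P) (hP : P ∈ copulasWithPdf d) :
    klDiv P volume ≠ ⊤ := fun htop => h.1 <| by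
  rw [diffEntropy_eq_neg_klDiv hP, htop, EReal.coe_ennreal_top, EReal.neg_top]

lemma integrable_klFun_pdfOf (hP : P ∈ copulasWithPdf d) (hfin : klDiv P volume ≠ ⊤) :
    Integrable fun u => klFun (pdfOf P u) :=
  (isProbDensity_pdfOf hP).lintegral_klFun_ne_top_iff.1 <|
    klDiv_volume_eq_lintegral_klFun_pdfOf hP ▸ hfin

/-- The densities of the elements of `feasibleCopulas φ α`. -/
def feasiblePdfs (φ : Cube d → Fin q → ℝ) (α : Fin q → ℝ) : Set (Cube d → ℝ) :=
  couplingDensities (fun _ => volume) (fun j u => φ u j) α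

lemma isProbDensity_of_mem_feasiblePdfs {p : Cube d → ℝ} (hp : p ∈ feasiblePdfs φ α) :
    IsProbDensity volume p :=
  hp.1

lemma pdfOf_mem_feasiblePdfs (hP : P ∈ feasibleCopulas φ α) : pdfOf P ∈ feasiblePdfs φ α := by
  have hp := isProbDensity_pdfOf hP.1
  have hint := hp.integral_withDensity
  rw [withDensity_pdfOf hP.1] at hint
  refine ⟨hp, fun k => ?_⟩
  change ∫ u, couplingTests (fun j u => φ u j) k u * pdfOf P u = _
  rw [← hint]
  rcases k with ⟨i, A⟩ | j
  · have hmap := integral_map (μ := P) (measurable_pi_apply i).aemeasurable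
      (measurable_one.indicator A.2 : Measurable (A.1.indicator (1 : I → ℝ))).aestronglyMeasurable
    rw [hP.1.2.2 i, integral_indicator_one A.2] at hmap
    exact hmap.symm
  · exact (hP.2 j).2

/-- The logarithm `θᵀ φ(u) + ∑ᵢ gᵢ(uᵢ)` of a density of exponential form, where `gᵢ = log fᵢ`. -/
def logDensity (φ : Cube d → Fin q → ℝ) (θ : Fin q → ℝ) (g : Fin d → I → ℝ) (u : Cube d) : ℝ :=
  ∑ j, θ j * φ u j + ∑ i, g i (u i)

variable (hmeas : ∀ j, Measurable fun u => φ u j) (hbdd : ∀ j, ∃ C : ℝ, ∀ u, |φ u j| ≤ C)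
include hmeas hbdd

lemma convex_feasiblePdfs : Convex ℝ (feasiblePdfs φ α) :=
  convex_momentDensities (measurable_couplingTests hmeas) (exists_abs_couplingTests_le hbdd)

lemma withDensity_mem_feasibleCopulas {p : Cube d → ℝ} (hp : p ∈ feasiblePdfs φ α) :
    volume.withDensity (fun u => ENNReal.ofReal (p u)) ∈ feasibleCopulas φ α := by
  have hprob := hp.1.isProbabilityMeasure_withDensity
  have hint := hp.1.integral_withDensity
  refine ⟨⟨hprob, withDensity_absolutelyContinuous _ _, fun i => ?_⟩, fun j =>
    ⟨.of_bound (hmeas j).aestronglyMeasurable _ (.of_forall (hbdd j).choose_spec),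
      (hint _).trans (hp.2 (.inr j))⟩⟩
  have heval : AEMeasurable (fun u : Cube d => u i)
    (volume.withDensity fun u => ENNReal.ofReal (p u)) := (measurable_pi_apply i).aemeasurable
  have := Measure.isProbabilityMeasure_map heval
  refine Measure.ext fun A hA => ?_
  rw [← measureReal_eq_measureReal_iff, ← integral_indicator_one hA,
    integral_map heval
      (measurable_one.indicator hA : Measurable (A.indicator (1 : I → ℝ))).aestronglyMeasurable]
  exact (hint _).trans (hp.2 (.inl (i, ⟨A, hA⟩)))

lemma isMaxEntropyCopula_iff_isEntropyMinimizer
    (hfin : ∃ P ∈ feasibleCopulas φ α, klDiv P volume ≠ ⊤) (hP : P ∈ feasibleCopulas φ α) :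
    IsMaxEntropyCopula φ α P ↔ IsEntropyMinimizer volume (feasiblePdfs φ α) (pdfOf P) := by
  obtain ⟨P₀, hP₀, hP₀fin⟩ := hfin
  have hkl := fun {P' : Measure (Cube d)} => klDiv_volume_eq_lintegral_klFun_pdfOf (P := P')
  rw [isEntropyMinimizer_iff_lintegral_le (fun _ => isProbDensity_of_mem_feasiblePdfs)
    (pdfOf_mem_feasiblePdfs hP), ← hkl hP.1]
  refine ⟨fun h => ?_, fun h => ⟨hP, fun P' hP' => ?_⟩⟩
  · have hle := fun {P'} (hP' : P' ∈ feasibleCopulas φ α) =>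
      (diffEntropy_le_iff_klDiv_le hP'.1 hP.1).1 (h.2 hP')
    refine ⟨ne_top_of_le_ne_top hP₀fin (hle hP₀), fun p hp => ?_⟩
    have hmem := withDensity_mem_feasibleCopulas hmeas hbdd hp
    refine (hle hmem).trans_eq ((hkl hmem.1).trans (lintegral_congr_ae ?_))
    exact (pdfOf_withDensity (isProbDensity_of_mem_feasiblePdfs hp)).fun_comp
      fun x => ENNReal.ofReal (klFun x)
  · exact (diffEntropy_le_iff_klDiv_le hP'.1 hP.1).2 <|
      (h.2 _ (pdfOf_mem_feasiblePdfs hP')).trans_eq (hkl hP'.1).symm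

theorem exists_isMaxEntropyCopula (hfin : ∃ P ∈ feasibleCopulas φ α, klDiv P volume ≠ ⊤) :
    ∃ P, IsMaxEntropyCopula φ α P := by
  obtain ⟨P₀, hP₀, hP₀fin⟩ := hfin
  obtain ⟨p, hp⟩ := exists_isEntropyMinimizer_momentDensities (measurable_couplingTests hmeas)
    (exists_abs_couplingTests_le hbdd)
    ⟨pdfOf P₀, pdfOf_mem_feasiblePdfs hP₀, integrable_klFun_pdfOf hP₀.1 hP₀fin⟩
  have hmem := withDensity_mem_feasibleCopulas hmeas hbdd hp.mem
  exact ⟨_, (isMaxEntropyCopula_iff_isEntropyMinimizer hmeas hbdd ⟨P₀, hP₀, hP₀fin⟩ hmem).2 <|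
    hp.of_ae_eq (pdfOf_mem_feasiblePdfs hmem) (pdfOf_withDensity hp.mem.1).symm⟩

theorem IsMaxEntropyCopula.eq (hfin : ∃ P ∈ feasibleCopulas φ α, klDiv P volume ≠ ⊤)
    (hP : IsMaxEntropyCopula φ α P) (hQ : IsMaxEntropyCopula φ α Q) : P = Q := by
  have hae := ((isMaxEntropyCopula_iff_isEntropyMinimizer hmeas hbdd hfin hP.1).1 hP).ae_eq
    (convex_feasiblePdfs hmeas hbdd) (fun _ => isProbDensity_of_mem_feasiblePdfs)
    ((isMaxEntropyCopula_iff_isEntropyMinimizer hmeas hbdd hfin hQ.1).1 hQ)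
  rw [← withDensity_pdfOf hP.1.1, ← withDensity_pdfOf hQ.1.1]
  exact withDensity_congr_ae (hae.fun_comp ENNReal.ofReal)

theorem IsMaxEntropyCopula.exists_pdfOf_ae_eq_exp_sum (hP : IsMaxEntropyCopula φ α P)
    (hpos : ∃ Q ∈ feasibleCopulas φ α, klDiv Q volume ≠ ⊤ ∧ ∀ᵐ u, 0 < pdfOf Q u) :
    ∃ (θ : Fin q → ℝ) (g : Fin d → I → ℝ), (∀ i, Measurable (g i)) ∧
      pdfOf P =ᵐ[volume] fun u => Real.exp (logDensity φ θ g u) := by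
  obtain ⟨Q, hQ, hQfin, hQpos⟩ := hpos
  have hmin := (isMaxEntropyCopula_iff_isEntropyMinimizer hmeas hbdd ⟨Q, hQ, hQfin⟩ hP.1).1 hP
  have hPpos := hmin.ae_pos (convex_feasiblePdfs hmeas hbdd)
    (fun _ => isProbDensity_of_mem_feasiblePdfs) (pdfOf_mem_feasiblePdfs hQ)
    (integrable_klFun_pdfOf hQ.1 hQfin) hQpos
  obtain ⟨θ, g, hg, hlog⟩ := hmin.exists_log_ae_eq_sum hmeas hbdd hPpos
  refine ⟨θ, g, hg, ?_⟩
  filter_upwards [hlog, hPpos] with u hu hu0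
  rw [logDensity, ← hu, Real.exp_log hu0]

end Copula

section ExponentialForm

/-! ### Copulas of exponential form -/

variable {d q : ℕ} {φ : Cube d → Fin q → ℝ} {α θ : Fin q → ℝ} {g : Fin d → I → ℝ}
  {P Q : Measure (Cube d)}

lemma measurePreserving_eval_volume (i : Fin d) : MeasurePreserving fun u : Cube d => u i :=
  measurePreserving_eval (fun _ => volume) i

theorem hasExponentialForm_iff :
    HasExponentialForm φ P ↔ ∃ θ g, (∀ i, Integrable (g i)) ∧
      P = volume.withDensity fun u => ENNReal.ofReal (Real.exp (logDensity φ θ g u)) := by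
  have hexp : ∀ θ (g : Fin d → I → ℝ) u, Real.exp (logDensity φ θ g u)
      = Real.exp (∑ j, θ j * φ u j) * ∏ i, Real.exp (g i (u i)) := fun θ g u => by
    rw [logDensity, Real.exp_add, Real.exp_sum Finset.univ fun i => g i (u i)]
  constructor
  · rintro ⟨θ, f, -, hpos, hint, rfl⟩
    refine ⟨θ, fun i t => Real.log (f i t), hint, withDensity_congr_ae ?_⟩
    have hpos' : ∀ᵐ u : Cube d, ∀ i, 0 < f i (u i) := ae_all_iff.2 fun i =>
      (measurePreserving_eval_volume i).quasiMeasurePreserving.ae (hpos i)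
    filter_upwards [hpos'] with u hu
    simp only [hexp, Real.exp_log (hu _)]
  · rintro ⟨θ, g, hint, rfl⟩
    exact ⟨θ, fun i t => Real.exp (g i t), fun _ _ => (Real.exp_pos _).le,
      fun _ => .of_forall fun _ => Real.exp_pos _, by simpa only [Real.log_exp] using hint,
      by simp only [hexp]⟩

lemma integrable_comp_eval_of_mem_copulasWithPdf (hP : P ∈ copulasWithPdf d)
    (hg : ∀ i, Integrable (g i)) (i : Fin d) : Integrable (fun u => g i (u i)) P :=
  (measurePreserving_eval_of_mem_copulasWithPdf hP i).integrable_comp_of_integrable (hg i)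

lemma integrable_logDensity (hP : P ∈ feasibleCopulas φ α) (hg : ∀ i, Integrable (g i)) :
    Integrable (logDensity φ θ g) P :=
  (integrable_finsetSum _ fun j _ => (hP.2 j).1.const_mul (θ j)).add <|
    integrable_finsetSum _ fun i _ => integrable_comp_eval_of_mem_copulasWithPdf hP.1 hg i

lemma integral_logDensity (hP : P ∈ feasibleCopulas φ α) (hg : ∀ i, Integrable (g i)) :
    ∫ u, logDensity φ θ g u ∂P = ∑ j, θ j * α j + ∑ i, ∫ t, g i t := by
  have hφint : ∀ j, Integrable (fun u => θ j * φ u j) P := fun j => (hP.2 j).1.const_mul (θ j)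
  have hgint := integrable_comp_eval_of_mem_copulasWithPdf hP.1 hg
  have hgeq : ∀ i, ∫ u, g i (u i) ∂P = ∫ t, g i t := fun i => by
    have hmp := measurePreserving_eval_of_mem_copulasWithPdf hP.1 i
    rw [← hmp.map_eq, integral_map hmp.aemeasurable
      (hmp.map_eq.symm ▸ (hg i).aestronglyMeasurable)]
  simp only [logDensity]
  rw [integral_add (integrable_finsetSum _ fun j _ => hφint j)
      (integrable_finsetSum _ fun i _ => hgint i),
    integral_finsetSum _ fun j _ => hφint j, integral_finsetSum _ fun i _ => hgint i]
  simp only [integral_const_mul, (hP.2 _).2, hgeq]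

variable (hmeas : ∀ j, Measurable fun u => φ u j)
include hmeas

lemma aemeasurable_logDensity (hg : ∀ i, AEMeasurable (g i)) : AEMeasurable (logDensity φ θ g) :=
  (Finset.measurable_fun_sum _ fun j _ => (hmeas j).const_mul (θ j)).aemeasurable.add <|
    Finset.aemeasurable_fun_sum _ fun i _ =>
      (hg i).comp_quasiMeasurePreserving (measurePreserving_eval_volume i).quasiMeasurePreserving

theorem HasExponentialForm.klDiv_add_klDiv_volume (hexp : HasExponentialForm φ Q)
    (hQ : Q ∈ feasibleCopulas φ α) (hP : P ∈ feasibleCopulas φ α) :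
    klDiv Q volume ≠ ⊤ ∧ klDiv P Q + klDiv Q volume = klDiv P volume := by
  obtain ⟨θ, g, hg, hQg⟩ := hasExponentialForm_iff.1 hexp
  have := hP.1.1
  have := hQ.1.1
  exact klDiv_add_klDiv_of_eq_withDensity_exp hP.1.2.1
    (aemeasurable_logDensity hmeas fun i => (hg i).aemeasurable) hQg
    (integrable_logDensity hP hg) (integrable_logDensity hQ hg)
    ((integral_logDensity hP hg).trans (integral_logDensity hQ hg).symm)

theorem HasExponentialForm.isMaxEntropyCopula (hexp : HasExponentialForm φ Q)
    (hQ : Q ∈ feasibleCopulas φ α) : IsMaxEntropyCopula φ α Q :=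
  ⟨hQ, fun _ hP => (diffEntropy_le_iff_klDiv_le hP.1 hQ.1).2 <|
    (hexp.klDiv_add_klDiv_volume hmeas hQ hP).2 ▸ le_add_self⟩

theorem HasExponentialForm.diffEntropy_sub_eq_klDiv (hexp : HasExponentialForm φ Q)
    (hQ : Q ∈ feasibleCopulas φ α) (hP : P ∈ feasibleCopulas φ α) :
    diffEntropy Q - diffEntropy P = ((klDiv P Q : ENNReal) : EReal) := by
  obtain ⟨hfin, hadd⟩ := hexp.klDiv_add_klDiv_volume hmeas hQ hP
  rw [diffEntropy_eq_neg_klDiv hQ.1, diffEntropy_eq_neg_klDiv hP.1, ← hadd, sub_eq_add_neg,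
    neg_neg, add_comm, ← sub_eq_add_neg, EReal.coe_ennreal_add, ← EReal.coe_ennreal_toReal hfin,
    EReal.add_sub_cancel_right]

variable (hbdd : ∀ j, ∃ C : ℝ, ∀ u, |φ u j| ≤ C)
include hbdd

theorem IsMaxEntropyCopula.hasExponentialForm (hP : IsMaxEntropyCopula φ α P)
    (hpos : ∃ Q ∈ feasibleCopulas φ α, klDiv Q volume ≠ ⊤ ∧ ∀ᵐ u, 0 < pdfOf Q u) :
    HasExponentialForm φ P := by
  obtain ⟨θ, g, hg, hpdf⟩ := hP.exists_pdfOf_ae_eq_exp_sum hmeas hbdd hpos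
  have hPg : P = volume.withDensity fun u => ENNReal.ofReal (Real.exp (logDensity φ θ g u)) :=
    (withDensity_pdfOf hP.1.1).symm.trans <| withDensity_congr_ae (hpdf.fun_comp ENNReal.ofReal)
  choose C hC using hbdd
  have hE : ∀ u, |∑ j, θ j * φ u j| ≤ ∑ j, |θ j| * C j := fun u =>
    (Finset.abs_sum_le_sum_abs _ _).trans <| Finset.sum_le_sum fun j _ => by
      rw [abs_mul]
      exact mul_le_mul_of_nonneg_left (hC j u) (abs_nonneg _)
  refine hasExponentialForm_iff.2 ⟨θ, g, fun i => ?_, hPg⟩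
  obtain ⟨M, hM⟩ := exists_ae_abs_le_of_map_eval_eq (μ := fun _ : Fin d => (volume : Measure I))
    hE hg ((congrArg _ hPg.symm).trans (hP.1.1.2.2 i))
  exact .of_bound (hg i).aestronglyMeasurable M hM

end ExponentialForm

theorem mainTheorem1_general {d q : ℕ} (φ : Cube d → Fin q → ℝ) (α : Fin q → ℝ)
    (hmeas : ∀ j, Measurable (fun u => φ u j))
    (hbdd : ∀ j, ∃ C : ℝ, ∀ u, |φ u j| ≤ C)
    (hfeas : ∃ P ∈ feasibleCopulas φ α, HasFiniteEntropy P) :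
    ∃ PM : Measure (Cube d),
      IsMaxEntropyCopula φ α PM ∧
      (∀ P, IsMaxEntropyCopula φ α P → P = PM) ∧
      (∀ P ∈ feasibleCopulas φ α, HasExponentialForm φ P → P = PM) ∧
      ((∃ P ∈ feasibleCopulas φ α, HasFiniteEntropy P ∧ ∀ᵐ u : Cube d, 0 < pdfOf P u) →
        HasExponentialForm φ PM ∧
        ∀ P ∈ feasibleCopulas φ α,
          diffEntropy PM - diffEntropy P = ((klDiv P PM : ENNReal) : EReal)) := by
  have hfin : ∃ P ∈ feasibleCopulas φ α, klDiv P volume ≠ ⊤ :=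
    hfeas.imp fun P hP => ⟨hP.1, hP.2.klDiv_ne_top hP.1.1⟩
  obtain ⟨PM, hmax⟩ := exists_isMaxEntropyCopula hmeas hbdd hfin
  have huniq : ∀ P, IsMaxEntropyCopula φ α P → P = PM :=
    fun P hP => hP.eq hmeas hbdd hfin hmax
  refine ⟨PM, hmax, huniq,
    fun P hP hexp => huniq P (hexp.isMaxEntropyCopula hmeas hP), fun hpos => ?_⟩
  have hexp : HasExponentialForm φ PM := hmax.hasExponentialForm hmeas hbdd <|
    hpos.imp fun P hP => ⟨hP.1, hP.2.1.klDiv_ne_top hP.1.1, hP.2.2⟩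
  exact ⟨hexp, fun P hP => hexp.diffEntropy_sub_eq_klDiv hmeas hmax.1 hP⟩

theorem mainTheorem1 {d q : ℕ} [NeZero q] (φ : Cube d → Fin q → ℝ) (α : Fin q → ℝ)
    (hmeas : ∀ j, Measurable (fun u => φ u j))
    (hbdd : ∃ C : ℝ, ∀ u j, |φ u j| ≤ C)
    (hP1 : ∀ u, φ u 0 = 1)
    (hfeas : ∃ P ∈ feasibleCopulas φ α, HasFiniteEntropy P) :
    ∃ PM : Measure (Cube d),
      -- the problem has exactly one solution
      IsMaxEntropyCopula φ α PM ∧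
      (∀ P, IsMaxEntropyCopula φ α P → P = PM) ∧
      -- no other feasible copula has a density of the exponential form
      (∀ P ∈ feasibleCopulas φ α, HasExponentialForm φ P → P = PM) ∧
      -- exponential form and Pythagorean identity, when the constraint does not force the
      -- density to vanish on a set of positive measure
      ((∃ P ∈ feasibleCopulas φ α, HasFiniteEntropy P ∧ ∀ᵐ u : Cube d, 0 < pdfOf P u) →
        HasExponentialForm φ PM ∧
        ∀ P ∈ feasibleCopulas φ α,
          diffEntropy PM - diffEntropy P = ((klDiv P PM : ENNReal) : EReal)) :=
  mainTheorem1_general φ α hmeas (fun j => hbdd.imp fun _ hC u => hC u j) hfeas
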